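/- Let $E$ be a locally compact Hausdorff space with a countable base, with its Borel $\sigma$-algebra. Let $(\hat P_t)_{t\ge 0}$ be an honest Feller–Dynkin semigroup on $C_0(E)$, i.e. a strongly continuous semigroup of bounded linear operators with $\hat P_0=I$ such that $0\le f\le 1$ implies $0\le \hat P_tf\le 1$, and whose representing kernels $P_t(x,\cdot)$, defined by $\hat P_tf(x)=\int f(y)\,P_t(x,dy)$, satisfy $P_t(x,E)=1$ for all $t\ge 0$, $x\in E$. Suppose the associated process is a diffusion: with $\Omega$ the (Polish) space of continuous maps $\omega:[0,\infty)\to E$ under the topology of uniform convergence on compact sets, there are, for $x\in E$, probability measures $\mathbb P^x$ on $(\Omega,\sigma(\omega\mapsto\omega(t):t\ge 0))$ such that for all $n\ge 0$, $0<t_1<\dots<t_n$ and Borel sets $C_0,\dots,C_n\subseteq E$, $$\mathbb P^x\big(\omega(0)\in C_0,\ \omega(t_1)\in C_1,\dots,\omega(t_n)\in C_n\big)=\mathbf 1_{C_0}(x)\int_{C_1}P_{t_1}(x,dx_1)\int_{C_2}P_{t_2-t_1}(x_1,dx_2)\cdots\int_{C_n}P_{t_n-t_{n-1}}(x_{n-1},dx_n),$$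 and $x\mapsto\mathbb P^x$ is continuous for the weak convergence of probability measures. Let $obs:E\to[0,1]$ be continuous and let $0<c<1$. For a pseudometric $m$ on $E$ with values in $[0,1]$ put $U_c(m)(\omega,\omega')=\sup_{t\ge 0}c^t\,m(\omega(t),\omega'(t))$ for $\omega,\omega'\in\Omega$, and $\mathcal G_c(m)(x,y)=\inf_{\gamma}\int U_c(m)\,d\gamma$, the infimum being over all couplings $\gamma$ of $\mathbb P^x$ and $\mathbb P^y$. Let $d^c_0(x,y)=|obs(x)-obs(y)|$, $d^c_{n+1}=\mathcal G_c(d^c_n)$ for $n\ge 0$, and $\overline d^c=\sup_{n\in\mathbb N}d^c_n$. Let the expressions $\mathcal L_\sigma$ and $\mathcal L_\tau$ be generated by $$f\in\mathcal L_\sigma ::= q\mid obs\mid 1-f\mid \textstyle\int g,\qquad g\in\mathcal L_\tau ::= f\circ ev_t\mid \min\{g_1,g_2\}\mid\max\{g_1,g_2\}\mid g\ominus q\mid g\oplus q,$$ with $q\in\mathbb Q\cap[0,1]$ and $t\in\mathbb Q_{\ge 0}$, interpreted as functions $E\to[0,1]$ and $\Omega\to[0,1]$ respectively: $q$, $obs$,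 $1-f$, $\min$ and $\max$ have their obvious meaning, $(\int g)(x)=\int g\,d\mathbb P^x$, $(f\circ ev_t)(\omega)=c^tf(\omega(t))$, $(g\ominus q)(\omega)=\max\{0,g(\omega)-q\}$ and $(g\oplus q)(\omega)=\min\{1,g(\omega)+q\}$. Let $\ell^c(x,y)=\sup_{f\in\mathcal L_\sigma}|f(x)-f(y)|$. Theorem. Every $d^c_n$ is a continuous pseudometric on $E$ with values in $[0,1]$ (so that $\overline d^c$ is well defined), and the two pseudometrics $\ell^c$ and $\overline d^c$ are equal: $\ell^c(x,y)=\overline d^c(x,y)$ for all $x,y\in E$. -/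

import Mathlib

open MeasureTheory Filter Topology
open scoped NNReal ENNReal ZeroAtInfty CompactlySupported

namespace TrajMetric

universe u

/-! ### Trajectories -/

/-- Continuous trajectories `[0, ∞) → E`, with the topology of locally uniform convergence
(the compact-open topology). -/
abbrev Traj (E : Type u) [TopologicalSpace E] : Type u := C(ℝ≥0, E)

/-- The σ-algebra on trajectories generated by the coordinate maps `ω ↦ ω t`. -/
instance Traj.instMeasurableSpace (E : Type u) [TopologicalSpace E] [m : MeasurableSpace E] :
    MeasurableSpace (Traj E) :=
  ⨆ t : ℝ≥0, m.comap (fun ω : Traj E => ω t)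

section TrajBorel

variable {E : Type u} [TopologicalSpace E] [MeasurableSpace E]

theorem Traj.measurable_eval (t : ℝ≥0) : Measurable (fun ω : Traj E => ω t) :=
  Measurable.of_comap_le (le_iSup (fun t : ℝ≥0 => MeasurableSpace.comap
    (fun ω : Traj E => ω t) inferInstance) t)

/-- The σ-algebra generated by the coordinate maps is the Borel σ-algebra. -/
instance Traj.instBorelSpace [LocallyCompactSpace E] [T2Space E] [SecondCountableTopology E]
    [BorelSpace E] : BorelSpace (Traj E) := by
  refine ⟨le_antisymm ?_ ?_⟩
  · refine iSup_le fun t => ?_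
    have h : @Measurable _ _ (borel (Traj E)) _ (fun ω : Traj E => ω t) := by
      let _ : MeasurableSpace (Traj E) := borel _
      have _ : BorelSpace (Traj E) := ⟨rfl⟩
      exact (continuous_eval_const t).measurable
    exact h.comap_le
  · rw [borel_eq_generateFrom_of_subbasis (ContinuousMap.compactOpen_eq (X := ℝ≥0) (Y := E))]
    refine MeasurableSpace.generateFrom_le ?_
    rintro _ ⟨K, hK, U, hU, rfl⟩
    let _ : MetricSpace E := TopologicalSpace.metrizableSpaceMetric E
    obtain ⟨D, hDc, hDd⟩ := TopologicalSpace.exists_countable_dense K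
    have key : {ω : Traj E | Set.MapsTo ω K U} =
        ⋃ n : ℕ, ⋂ d ∈ D, {ω : Traj E | ω d ∈ (Metric.thickening (1 / ((n : ℝ) + 1)) Uᶜ)ᶜ} := by
      ext ω
      simp only [Set.mem_ofPred_eq, Set.mem_iUnion, Set.mem_iInter]
      constructor
      · intro h
        obtain ⟨δ, hδ, hsub⟩ := (hK.image ω.continuous).exists_thickening_subset_open hU
          h.image_subset
        obtain ⟨n, hn⟩ := exists_nat_one_div_lt hδ
        refine ⟨n, fun d _ hd => ?_⟩
        obtain ⟨z, hz, hdz⟩ := Metric.mem_thickening_iff.1 hd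
        refine hz (hsub (Metric.mem_thickening_iff.2 ⟨ω d, ⟨d, d.2, rfl⟩, ?_⟩))
        rw [dist_comm]
        exact hdz.trans hn
      · rintro ⟨n, hn⟩ s hs
        have hcl : IsClosed {s : K | ω s ∈ (Metric.thickening (1 / ((n : ℝ) + 1)) Uᶜ)ᶜ} :=
          (Metric.isOpen_thickening.isClosed_compl).preimage
            (ω.continuous.comp continuous_subtype_val)
        have hall : (⟨s, hs⟩ : K) ∈
            {s : K | ω s ∈ (Metric.thickening (1 / ((n : ℝ) + 1)) Uᶜ)ᶜ} :=
          (hcl.closure_subset_iff.2 fun d hd => hn d hd) (hDd ⟨s, hs⟩)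
        by_contra hU'
        exact hall (Metric.self_subset_thickening (by positivity) _ hU')
    change MeasurableSet {ω : Traj E | Set.MapsTo ω K U}
    rw [key]
    exact MeasurableSet.iUnion fun n => MeasurableSet.biInter hDc fun d _ =>
      Traj.measurable_eval _ Metric.isOpen_thickening.isClosed_compl.measurableSet

end TrajBorel

/-! ### Feller-Dynkin semigroups and diffusions -/

/-- A Feller-Dynkin semigroup: a strongly continuous semigroup of bounded operators on `C₀(E)`
such that `0 ≤ f ≤ 1` implies `0 ≤ P̂ₜ f ≤ 1`. -/
structure FDSemigroup (E : Type u) [TopologicalSpace E] where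
  op : ℝ≥0 → C₀(E, ℝ) →L[ℝ] C₀(E, ℝ)
  op_comp : ∀ s t, (op s).comp (op t) = op (s + t)
  op_zero : op 0 = ContinuousLinearMap.id ℝ C₀(E, ℝ)
  strongly_continuous : ∀ f, Tendsto (fun t => ‖op t f - f‖) (𝓝[>] 0) (𝓝 0)
  sub_markov : ∀ t (f : C₀(E, ℝ)), (∀ x, 0 ≤ f x ∧ f x ≤ 1) → ∀ x, 0 ≤ op t f x ∧ op t f x ≤ 1

namespace FDSemigroup

variable {E : Type u} [TopologicalSpace E]

theorem op_nonneg (S : FDSemigroup E) (t : ℝ≥0) (f : C₀(E, ℝ)) (hf : ∀ x, 0 ≤ f x) (x : E) :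
    0 ≤ S.op t f x := by
  have hpos : (0 : ℝ) < ‖f‖ + 1 := by positivity
  have hle : ∀ y, f y ≤ ‖f‖ := fun y =>
    (le_abs_self _).trans (f.toBCF.norm_coe_le_norm y)
  have h := (S.sub_markov t ((‖f‖ + 1)⁻¹ • f) (fun y => ⟨by
    simpa using mul_nonneg (inv_nonneg.2 hpos.le) (hf y), by
    simp only [ZeroAtInftyContinuousMap.smul_apply, smul_eq_mul]
    rw [inv_mul_le_iff₀ hpos]
    linarith [hle y]⟩) x).1
  simp only [map_smul, ZeroAtInftyContinuousMap.smul_apply, smul_eq_mul] at h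
  exact nonneg_of_mul_nonneg_right h (inv_pos.2 hpos)

/-- The positive functional `f ↦ (P̂ₜ f)(x)` on compactly supported continuous functions. -/
noncomputable def functional (S : FDSemigroup E) (t : ℝ≥0) (x : E) : C_c(E, ℝ) →ₚ[ℝ] ℝ :=
  PositiveLinearMap.mk₀
    { toFun := fun f => S.op t (f : C₀(E, ℝ)) x
      map_add' := fun f g => by
        have h : ((f + g : C_c(E, ℝ)) : C₀(E, ℝ)) = (f : C₀(E, ℝ)) + (g : C₀(E, ℝ)) := rfl
        rw [h, map_add]
        rfl
      map_smul' := fun a f => by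
        have h : ((a • f : C_c(E, ℝ)) : C₀(E, ℝ)) = a • (f : C₀(E, ℝ)) := rfl
        rw [h, map_smul]
        rfl }
    (fun f hf => S.op_nonneg t (f : C₀(E, ℝ)) (fun y => hf y) x)

variable [LocallyCompactSpace E] [T2Space E] [MeasurableSpace E] [BorelSpace E]

/-- The transition measure `Pₜ(x, ·)`: the measure that represents `f ↦ (P̂ₜ f)(x)` in the Riesz
representation theorem. -/
noncomputable def transition (S : FDSemigroup E) (t : ℝ≥0) (x : E) : Measure E :=
  RealRMK.rieszMeasure (S.functional t x)

theorem integral_transition (S : FDSemigroup E) (t : ℝ≥0) (x : E) (f : C_c(E, ℝ)) :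
    ∫ y, f y ∂(S.transition t x) = S.op t (f : C₀(E, ℝ)) x :=
  RealRMK.integral_rieszMeasure (S.functional t x) f

/-- The semigroup is honest if no mass is lost. -/
def IsHonest (S : FDSemigroup E) : Prop := ∀ t x, S.transition t x Set.univ = 1

/-- For a list `(t₁, C₁), …, (tₙ, Cₙ)` with `s < t₁ < ⋯ < tₙ`, the iterated integral
`∫_{C₁} P_{t₁ - s}(x, dx₁) ∫_{C₂} P_{t₂ - t₁}(x₁, dx₂) ⋯ ∫_{Cₙ} P_{tₙ - tₙ₋₁}(xₙ₋₁, dxₙ)`. -/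
noncomputable def cylinderMass (S : FDSemigroup E) : ℝ≥0 → List (ℝ≥0 × Set E) → E → ℝ≥0∞
  | _, [], _ => 1
  | s, (t, C) :: l, x => ∫⁻ y in C, S.cylinderMass t l y ∂(S.transition (t - s) x)

end FDSemigroup

/-- A diffusion: an honest Feller-Dynkin process with continuous trajectories.  The measure `law x`
is the law of the process started at `x`, i.e. the probability measure on trajectories whose
finite-dimensional distributions are those given by the semigroup and the initial distribution
`δₓ`; it depends weakly continuously on `x`. -/
structure Diffusion (E : Type u) [TopologicalSpace E] [LocallyCompactSpace E] [T2Space E]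
    [SecondCountableTopology E] [MeasurableSpace E] [BorelSpace E] extends FDSemigroup E where
  honest : toFDSemigroup.IsHonest
  law : E → ProbabilityMeasure (Traj E)
  law_cylinder : ∀ (x : E) (C₀ : Set E) (l : List (ℝ≥0 × Set E)), MeasurableSet C₀ →
    (∀ p ∈ l, 0 < p.1 ∧ MeasurableSet p.2) → l.Pairwise (fun p q => p.1 < q.1) →
    (law x : Measure (Traj E)) {ω | ω 0 ∈ C₀ ∧ ∀ p ∈ l, ω p.1 ∈ p.2} =
      C₀.indicator (toFDSemigroup.cylinderMass 0 l) x
  continuous_law : Continuous law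

/-! ### Pseudometrics and optimal transport -/

/-- 1-bounded pseudometrics. -/
structure IsPseudometric {X : Type u} (m : X → X → ℝ) : Prop where
  nonneg : ∀ x y, 0 ≤ m x y
  le_one : ∀ x y, m x y ≤ 1
  self : ∀ x, m x x = 0
  symm : ∀ x y, m x y = m y x
  triangle : ∀ x y z, m x z ≤ m x y + m y z

/-- The couplings of `μ` and `ν`: measures on the product with marginals `μ` and `ν`. -/
def couplings {X : Type u} [MeasurableSpace X] (μ ν : ProbabilityMeasure X) :
    Set (ProbabilityMeasure (X × X)) :=
  {γ | (γ : Measure (X × X)).map Prod.fst = μ ∧ (γ : Measure (X × X)).map Prod.snd = ν}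

/-- The optimal transport cost `W(k)(μ, ν)` for the cost function `k`. -/
noncomputable def transportCost {X : Type u} [MeasurableSpace X] (k : X → X → ℝ)
    (μ ν : ProbabilityMeasure X) : ℝ :=
  ⨅ γ : couplings μ ν, ∫ p, k p.1 p.2 ∂((γ : ProbabilityMeasure (X × X)) : Measure (X × X))

/-- The discounted uniform pseudometric `U_c(m)(ω, ω') = sup_t c^t m(ω(t), ω'(t))`. -/
noncomputable def discUnif {E : Type u} [TopologicalSpace E] (c : ℝ) (m : E → E → ℝ)
    (ω ω' : Traj E) : ℝ :=
  ⨆ t : ℝ≥0, c ^ (t : ℝ) * m (ω t) (ω' t)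

/-! ### The logic -/

/-- The two sorts of expressions: those on states and those on trajectories. -/
inductive LogicSort : Type
  | state : LogicSort
  | traj : LogicSort

/-- The expressions of the logic: `LogicExpr .state` is `𝓛_σ` and `LogicExpr .traj` is `𝓛_τ`. -/
inductive LogicExpr : LogicSort → Type
  | const (q : Set.Icc (0 : ℚ) 1) : LogicExpr .state
  | obs : LogicExpr .state
  | compl (f : LogicExpr .state) : LogicExpr .state
  | integral (g : LogicExpr .traj) : LogicExpr .state
  | ev (f : LogicExpr .state) (t : ℚ≥0) : LogicExpr .traj
  | min (g₁ g₂ : LogicExpr .traj) : LogicExpr .traj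
  | max (g₁ g₂ : LogicExpr .traj) : LogicExpr .traj
  | minus (g : LogicExpr .traj) (q : Set.Icc (0 : ℚ) 1) : LogicExpr .traj
  | plus (g : LogicExpr .traj) (q : Set.Icc (0 : ℚ) 1) : LogicExpr .traj

/-- The domain on which the expressions of a given sort are interpreted. -/
abbrev Domain (E : Type u) [TopologicalSpace E] : LogicSort → Type u
  | .state => E
  | .traj => Traj E

namespace Diffusion

variable {E : Type u} [TopologicalSpace E] [LocallyCompactSpace E] [T2Space E]
  [SecondCountableTopology E] [MeasurableSpace E] [BorelSpace E]

/-- The functional `𝓖_c(m)(x, y) = W(U_c(m))(ℙˣ, ℙʸ)`. -/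
noncomputable def functionalG (D : Diffusion E) (c : ℝ) (m : E → E → ℝ) (x y : E) : ℝ :=
  transportCost (discUnif c m) (D.law x) (D.law y)

/-- The iterates `d₀(x, y) = |obs(x) - obs(y)|` and `dₙ₊₁ = 𝓖_c(dₙ)`. -/
noncomputable def iterDist (D : Diffusion E) (obs : E → ℝ) (c : ℝ) : ℕ → E → E → ℝ
  | 0 => fun x y => |obs x - obs y|
  | n + 1 => D.functionalG c (D.iterDist obs c n)

/-- The pseudometric `supₙ dₙ`. -/
noncomputable def fixDist (D : Diffusion E) (obs : E → ℝ) (c : ℝ) (x y : E) : ℝ :=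
  ⨆ n : ℕ, D.iterDist obs c n x y

/-- The interpretation of expressions as functions on states, resp. on trajectories. -/
noncomputable def interp (D : Diffusion E) (obs : E → ℝ) (c : ℝ) :
    {k : LogicSort} → LogicExpr k → Domain E k → ℝ
  | _, .const q => fun _ => ((q : ℚ) : ℝ)
  | _, .obs => fun x => obs x
  | _, .compl f => fun x => 1 - D.interp obs c f x
  | _, .integral g => fun x => ∫ ω, D.interp obs c g ω ∂(D.law x : Measure (Traj E))
  | _, .ev f t => fun ω => c ^ (t : ℝ) * D.interp obs c f (ω (t : ℝ≥0))
  | _, .min g₁ g₂ => fun ω => min (D.interp obs c g₁ ω) (D.interp obs c g₂ ω)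
  | _, .max g₁ g₂ => fun ω => max (D.interp obs c g₁ ω) (D.interp obs c g₂ ω)
  | _, .minus g q => fun ω => max 0 (D.interp obs c g ω - ((q : ℚ) : ℝ))
  | _, .plus g q => fun ω => min 1 (D.interp obs c g ω + ((q : ℚ) : ℝ))

/-- Expressions are interpreted as continuous functions with values in `[0, 1]`. -/
theorem interp_wellDefined (D : Diffusion E) (obs : E → ℝ) (hobs : Continuous obs)
    (hobs01 : ∀ x, 0 ≤ obs x ∧ obs x ≤ 1) (c : ℝ) (hc0 : 0 < c) (hc1 : c < 1) :
    ∀ {k : LogicSort} (e : LogicExpr k), (match k, e with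
      | .state, f => Continuous (D.interp obs c f) ∧
          ∀ x, 0 ≤ D.interp obs c f x ∧ D.interp obs c f x ≤ 1
      | .traj, g => Continuous (D.interp obs c g) ∧
          ∀ ω, 0 ≤ D.interp obs c g ω ∧ D.interp obs c g ω ≤ 1) := by
  intro k e
  induction e with
  | const q =>
    have h := q.2
    refine ⟨continuous_const, fun x => ⟨?_, ?_⟩⟩
    · simpa [interp] using h.1
    · simpa [interp] using (by exact_mod_cast h.2 : (((q : ℚ) : ℝ)) ≤ 1)
  | obs => exact ⟨hobs, hobs01⟩
  | compl f ih =>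
    exact ⟨continuous_const.sub ih.1, fun x => ⟨by simpa [interp] using (ih.2 x).2,
      by simpa [interp] using (ih.2 x).1⟩⟩
  | integral g ih =>
    obtain ⟨hc, hb⟩ := ih
    have hbdd : ∀ ω : Traj E, ‖D.interp obs c g ω‖ ≤ 1 := fun ω => by
      rw [Real.norm_eq_abs, abs_le]
      exact ⟨by linarith [(hb ω).1], (hb ω).2⟩
    let G : BoundedContinuousFunction (Traj E) ℝ :=
      BoundedContinuousFunction.ofNormedAddCommGroup (D.interp obs c g) hc 1 hbdd
    refine ⟨?_, fun x => ⟨integral_nonneg fun ω => (hb ω).1, ?_⟩⟩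
    · refine continuous_iff_continuousAt.2 fun x => ?_
      exact (ProbabilityMeasure.tendsto_iff_forall_integral_tendsto.1
        (D.continuous_law.tendsto x)) G
    · have h := norm_integral_le_of_norm_le_const (μ := (D.law x : Measure (Traj E)))
        (Eventually.of_forall hbdd)
      simpa [interp] using (le_abs_self _).trans h
  | ev f t ih =>
    have h1 : c ^ (t : ℝ) ≤ 1 := Real.rpow_le_one hc0.le hc1.le (by positivity)
    have h0 : 0 ≤ c ^ (t : ℝ) := Real.rpow_nonneg hc0.le _
    exact ⟨continuous_const.mul (ih.1.comp (continuous_eval_const (t : ℝ≥0))),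
      fun ω => ⟨mul_nonneg h0 (ih.2 _).1, mul_le_one₀ h1 (ih.2 _).1 (ih.2 _).2⟩⟩
  | min g₁ g₂ ih₁ ih₂ =>
    exact ⟨ih₁.1.min ih₂.1, fun ω => ⟨le_min (ih₁.2 ω).1 (ih₂.2 ω).1,
      (min_le_left _ _).trans (ih₁.2 ω).2⟩⟩
  | max g₁ g₂ ih₁ ih₂ =>
    exact ⟨ih₁.1.max ih₂.1, fun ω => ⟨(ih₁.2 ω).1.trans (le_max_left _ _),
      max_le (ih₁.2 ω).2 (ih₂.2 ω).2⟩⟩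
  | minus g q ih =>
    have hq : (0 : ℝ) ≤ ((q : ℚ) : ℝ) := by exact_mod_cast q.2.1
    exact ⟨continuous_const.max (ih.1.sub continuous_const), fun ω => ⟨le_max_left _ _,
      max_le zero_le_one (by linarith [(ih.2 ω).2])⟩⟩
  | plus g q ih =>
    have hq : (0 : ℝ) ≤ ((q : ℚ) : ℝ) := by exact_mod_cast q.2.1
    exact ⟨continuous_const.min (ih.1.add continuous_const), fun ω => ⟨le_min zero_le_one
      (by linarith [(ih.2 ω).1]), min_le_left _ _⟩⟩

/-- The pseudometric `ℓ^c(x, y) = sup_f |f(x) - f(y)|`, over the expressions `f` on states. -/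
noncomputable def logicDist (D : Diffusion E) (obs : E → ℝ) (c : ℝ) (x y : E) : ℝ :=
  ⨆ f : LogicExpr .state, |D.interp obs c f x - D.interp obs c f y|

end Diffusion

end TrajMetric

/-! The argument is a Kantorovich duality tied to a Stone-Weierstrass argument. By duality, the
transport cost of a continuous pseudometric `k` is the supremum of `∫ h dμ - ∫ h dν` over `[0,
1]`-valued `k`-nonexpansive `h`. The logic produces enough such `h`, and only such `h`.

Upper bound on the logical distance: by induction on expressions, each one is nonexpansive for some
`dₙ` (on states) or `U_c(dₙ)` (on trajectories). Integration raises `n` by one, through the easy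
half of duality. The `dₙ` increase with `n`, so subexpressions of different depth can be compared
(`exists_nonexpansive_interp`).

Lower bound: expressions nonexpansive for `dₙ` come arbitrarily close to `dₙ(x, y)`, by induction on
`n` (`separates_iterDist`). Evaluation at a nearly optimal rational time transfers this to
`U_c(dₙ)`. Truncations then give two-point interpolation of any nonexpansive `h`, and `min` and
`max` upgrade it to a sequence converging pointwise to `h`. Taking `h` a nearly optimal dual
potential and passing to the limit under the integral gives `dₙ₊₁` (`Separates.succ`).

Duality up to `ε` (`exists_nonexpansive_transportCost_le`) is reduced to a finite transport problem
by quantizing both measures; the finite case is a separation of convex sets. Neither tightness nor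
an optimal coupling is needed. Duality also makes the cost a pseudometric without gluing couplings,
and makes it weakly continuous, so every `dₙ` stays continuous (`tendsto_transportCost`,
`continuous_discUnif`). -/

open MeasureTheory Filter Topology
open scoped NNReal ENNReal ZeroAtInfty CompactlySupported

namespace TrajMetric

/-! ### Finite transport duality -/

/-- Finite transport duality: if every pair of dual potentials has value at most `S`, then
there is a transport plan of cost at most `S`. -/
theorem exists_plan_of_dual_le {I : Type*} [Fintype I] (k : I → I → ℝ) {p q : I → ℝ}
    (hp : p ∈ stdSimplex ℝ I) (hq : q ∈ stdSimplex ℝ I) {S : ℝ}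
    (hS : ∀ a b : I → ℝ, (∀ i j, a i + b j ≤ k i j) → ∑ i, p i * a i + ∑ j, q j * b j ≤ S) :
    ∃ w : I × I → ℝ, (∀ z, 0 ≤ w z) ∧ (∀ i, ∑ j, w (i, j) = p i) ∧
      (∀ j, ∑ i, w (i, j) = q j) ∧ ∑ z, w z * k z.1 z.2 ≤ S := by
  classical
  let L : (I × I → ℝ) →ₗ[ℝ] (I → ℝ) × (I → ℝ) × ℝ :=
    { toFun := fun w => (fun i => ∑ j, w (i, j), fun j => ∑ i, w (i, j), ∑ z, w z * k z.1 z.2)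
      map_add' := fun v w => by
        simp only [Pi.add_apply, Finset.sum_add_distrib, add_mul, Prod.mk_add_mk]
        rfl
      map_smul' := fun r w => by
        simp only [Pi.smul_apply, smul_eq_mul, ← Finset.mul_sum, mul_assoc, RingHom.id_apply,
          Prod.smul_mk]
        rfl }
  by_contra hcon
  push Not at hcon
  -- If no plan works, the compact convex set of (marginals, cost) triples misses the closed convex
  -- target, and a linear functional separates them strictly. Its coefficients `A`, `B`, `l` will be
  -- rescaled into dual potentials.
  have hdisj : Disjoint (L '' stdSimplex ℝ (I × I)) ({p} ×ˢ {q} ×ˢ Set.Iic S) := by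
    rw [Set.disjoint_left]
    rintro _ ⟨w, hw, rfl⟩ ⟨h1, h2, h3⟩
    have := hcon w hw.1 (fun i => congrFun h1 i) (fun j => congrFun h2 j)
    exact absurd h3 (not_le.2 this)
  obtain ⟨f, u, v, hu, huv, hv⟩ := geometric_hahn_banach_compact_closed
    ((convex_stdSimplex ℝ (I × I)).linear_image L)
    ((isCompact_stdSimplex ℝ (I × I)).image L.continuous_of_finiteDimensional)
    ((convex_singleton p).prod ((convex_singleton q).prod (convex_Iic S)))
    (isClosed_singleton.prod (isClosed_singleton.prod isClosed_Iic)) hdisj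
  set A : I → ℝ := fun i => f (Pi.single i 1, 0, 0) with hA
  set B : I → ℝ := fun j => f (0, Pi.single j 1, 0) with hB
  set l : ℝ := f (0, 0, 1) with hl
  have hf : ∀ x y r, f (x, y, r) = ∑ i, x i * A i + ∑ j, y j * B j + r * l := by
    intro x y r
    have h1 : ((x, y, r) : (I → ℝ) × (I → ℝ) × ℝ) =
        (∑ i, x i • ((Pi.single i 1, 0, 0) : (I → ℝ) × (I → ℝ) × ℝ)) +
        (∑ j, y j • ((0, Pi.single j 1, 0) : (I → ℝ) × (I → ℝ) × ℝ)) +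
        r • ((0, 0, 1) : (I → ℝ) × (I → ℝ) × ℝ) := by
      refine Prod.ext ?_ (Prod.ext ?_ ?_)
      · ext i
        simp [Prod.fst_sum, Finset.sum_apply, Pi.single_apply]
      · ext i
        simp [Prod.fst_sum, Prod.snd_sum, Finset.sum_apply, Pi.single_apply]
      · simp [Prod.snd_sum]
    rw [h1]
    simp only [map_add, map_sum, map_smul, smul_eq_mul, hA, hB, hl]
  have hpair : ∀ i j, A i + B j + k i j * l < u := by
    intro i j
    have := hu _ ⟨Pi.single (i, j) 1, single_mem_stdSimplex ℝ (i, j), rfl⟩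
    have hLs : L (Pi.single (i, j) 1) = (Pi.single i 1, Pi.single j 1, k i j) := by
      refine Prod.ext ?_ (Prod.ext ?_ ?_)
      · ext a
        by_cases h : a = i <;> simp [L, Pi.single_apply, h, -Finset.sum_boole]
      · ext a
        by_cases h : a = j <;> simp [L, Pi.single_apply, h, -Finset.sum_boole]
      · simp [L, Pi.single_apply]
    rw [hLs, hf] at this
    simpa [Pi.single_apply] using this
  have hdual : ∀ r ≤ S, v < ∑ i, p i * A i + ∑ j, q j * B j + r * l := by
    intro r hr
    rw [← hf]
    exact hv _ ⟨rfl, rfl, hr⟩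
  have hmul : ∑ i, p i * A i + ∑ j, q j * B j + (∑ i, ∑ j, p i * q j * k i j) * l < u := by
    have hw : (fun z : I × I => p z.1 * q z.2) ∈ stdSimplex ℝ (I × I) := by
      refine ⟨fun z => mul_nonneg (hp.1 _) (hq.1 _), ?_⟩
      rw [Fintype.sum_prod_type]
      simp [← Finset.mul_sum, hp.2, hq.2]
    have := hu _ ⟨_, hw, rfl⟩
    have hLs : L (fun z : I × I => p z.1 * q z.2) = (p, q, ∑ i, ∑ j, p i * q j * k i j) := by
      refine Prod.ext ?_ (Prod.ext ?_ ?_)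
      · ext a
        simp [L, ← Finset.mul_sum, hq.2]
      · ext a
        simp [L, ← Finset.sum_mul, hp.2]
      · simp [L, Fintype.sum_prod_type]
    rwa [hLs, hf] at this
  -- The product plan has the right marginals. If `l ≥ 0`, lowering its cost to `min S V` would
  -- enter the target without raising the functional, against the separation.
  have hlneg : l < 0 := by
    set V := ∑ i, ∑ j, p i * q j * k i j
    by_contra! h
    have := hdual (min S V) (min_le_left _ _)
    have := mul_le_mul_of_nonneg_right (min_le_right S V) h
    linarith
  have hm : 0 < -l := neg_pos.2 hlneg
  -- Dividing by `-l` turns `hpair` into dual feasibility; the slack `u` is absorbed into the first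
  -- potential, whose weights sum to one.
  have key := hS (fun i => (A i - u) / (-l)) (fun j => B j / (-l)) (fun i j => by
    rw [← add_div, div_le_iff₀ hm]
    linarith [hpair i j])
  have h1 : ∑ i, p i * ((A i - u) / (-l)) + ∑ j, q j * (B j / (-l)) =
      (∑ i, p i * A i + ∑ j, q j * B j - u) / (-l) := by
    simp only [← mul_div_assoc, ← Finset.sum_div, mul_sub, Finset.sum_sub_distrib,
      ← Finset.sum_mul, hp.2]
    ring
  rw [h1, div_le_iff₀ hm] at key
  linarith [hdual S le_rfl]

/-! ### Couplings that refine a finite plan -/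

section Coupling

variable {X : Type*} [MeasurableSpace X]

theorem real_preimage_mem_stdSimplex {I : Type*} [Fintype I] [MeasurableSpace I]
    [MeasurableSingletonClass I] (μ : ProbabilityMeasure X) {T : X → I} (hT : Measurable T) :
    (fun i => (μ : Measure X).real (T ⁻¹' {i})) ∈ stdSimplex ℝ I := by
  refine ⟨fun i => measureReal_nonneg, ?_⟩
  have h := sum_measureReal_preimage_singleton (μ := (μ : Measure X)) (f := T) Finset.univ
    (fun i _ => hT (measurableSet_singleton i))
  simpa using h

theorem integral_comp_eq_sum {I : Type*} [Fintype I] [MeasurableSpace I]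
    [MeasurableSingletonClass I] (μ : ProbabilityMeasure X) {T : X → I} (hT : Measurable T)
    (F : I → ℝ) :
    ∫ x, F (T x) ∂(μ : Measure X) = ∑ i, (μ : Measure X).real (T ⁻¹' {i}) * F i := by
  rw [← integral_map (f := F) hT.aemeasurable (measurable_of_finite F).aestronglyMeasurable]
  have := Measure.isFiniteMeasure_map (μ : Measure X) T
  rw [integral_fintype (Integrable.of_finite)]
  simp only [smul_eq_mul, map_measureReal_apply hT (measurableSet_singleton _)]

/-- A plan between the images of `μ` and `ν` under a finite-valued map lifts to a coupling. -/
theorem exists_coupling_of_plan {I : Type*} [Fintype I] [MeasurableSpace I]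
    [MeasurableSingletonClass I] (μ ν : ProbabilityMeasure X) {T : X → I} (hT : Measurable T)
    {w : I × I → ℝ} (hw : ∀ z, 0 ≤ w z)
    (hw1 : ∀ i, ∑ j, w (i, j) = (μ : Measure X).real (T ⁻¹' {i}))
    (hw2 : ∀ j, ∑ i, w (i, j) = (ν : Measure X).real (T ⁻¹' {j})) :
    ∃ γ ∈ couplings μ ν, ∀ F : I → I → ℝ,
      ∫ z, F (T z.1) (T z.2) ∂(γ : Measure (X × X)) = ∑ z, w z * F z.1 z.2 := by
  classical
  have hpos1 : ∀ z, w z ≠ 0 → (μ : Measure X) (T ⁻¹' {z.1}) ≠ 0 := by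
    rintro ⟨i, j⟩ hz h0
    have h1 : ∑ j, w (i, j) = 0 := by rw [hw1, measureReal_def, h0]; rfl
    exact hz ((Finset.sum_eq_zero_iff_of_nonneg fun _ _ => hw _).1 h1 j (Finset.mem_univ j))
  have hpos2 : ∀ z, w z ≠ 0 → (ν : Measure X) (T ⁻¹' {z.2}) ≠ 0 := by
    rintro ⟨i, j⟩ hz h0
    have h1 : ∑ i, w (i, j) = 0 := by rw [hw2, measureReal_def, h0]; rfl
    exact hz ((Finset.sum_eq_zero_iff_of_nonneg fun _ _ => hw _).1 h1 i (Finset.mem_univ i))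
  let P : I → Measure X := fun i => ProbabilityTheory.cond (μ : Measure X) (T ⁻¹' {i})
  let Q : I → Measure X := fun j => ProbabilityTheory.cond (ν : Measure X) (T ⁻¹' {j})
  -- Within each pair of cells, mass `w (i, j)` is spread as the product of the two conditional
  -- laws.
  let G : Measure (X × X) := ∑ z, ENNReal.ofReal (w z) • (P z.1).prod (Q z.2)
  have hsum1 : ∀ i, ∑ j, ENNReal.ofReal (w (i, j)) = (μ : Measure X) (T ⁻¹' {i}) := fun i => by
    rw [← ENNReal.ofReal_sum_of_nonneg (fun _ _ => hw _), hw1, ofReal_measureReal]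
  have hsum2 : ∀ j, ∑ i, ENNReal.ofReal (w (i, j)) = (ν : Measure X) (T ⁻¹' {j}) := fun j => by
    rw [← ENNReal.ofReal_sum_of_nonneg (fun _ _ => hw _), hw2, ofReal_measureReal]
  have hfst : G.map Prod.fst = μ := by
    rw [← Measure.mapₗ_apply_of_measurable measurable_fst]
    simp only [G, map_sum, map_smul]
    simp only [Measure.mapₗ_apply_of_measurable measurable_fst, Measure.map_fst_prod]
    -- A cell of measure zero has no conditional probability law, but by `hpos2` the weight then
    -- vanishes.
    have h : ∀ z : I × I, ENNReal.ofReal (w z) • Q z.2 Set.univ • P z.1 =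
        ENNReal.ofReal (w z) • P z.1 := by
      intro z
      by_cases hz : w z = 0
      · simp [hz]
      · have := ProbabilityTheory.cond_isProbabilityMeasure (hpos2 z hz)
        simp [Q]
    simp only [h, Fintype.sum_prod_type]
    simp only [← Finset.sum_smul, hsum1]
    exact ProbabilityTheory.sum_meas_smul_cond_fiber hT (μ : Measure X)
  have hsnd : G.map Prod.snd = ν := by
    rw [← Measure.mapₗ_apply_of_measurable measurable_snd]
    simp only [G, map_sum, map_smul]
    simp only [Measure.mapₗ_apply_of_measurable measurable_snd, Measure.map_snd_prod]
    have h : ∀ z : I × I, ENNReal.ofReal (w z) • P z.1 Set.univ • Q z.2 =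
        ENNReal.ofReal (w z) • Q z.2 := by
      intro z
      by_cases hz : w z = 0
      · simp [hz]
      · have := ProbabilityTheory.cond_isProbabilityMeasure (hpos1 z hz)
        simp [P]
    simp only [h, Fintype.sum_prod_type_right]
    simp only [← Finset.sum_smul, hsum2]
    exact ProbabilityTheory.sum_meas_smul_cond_fiber hT (ν : Measure X)
  have hprob : IsProbabilityMeasure G := by
    refine ⟨?_⟩
    have h := congrArg (fun m : Measure X => m Set.univ) hfst
    simpa [Measure.map_apply measurable_fst MeasurableSet.univ] using h
  refine ⟨⟨G, hprob⟩, ⟨hfst, hsnd⟩, fun F => ?_⟩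
  have hint : ∀ m : Measure (X × X), IsFiniteMeasure m →
      Integrable (fun z : X × X => F (T z.1) (T z.2)) m := by
    intro m _
    have hm : Measurable fun z : X × X => F (T z.1) (T z.2) :=
      (measurable_of_finite (fun s : I × I => F s.1 s.2)).comp
        ((hT.comp measurable_fst).prodMk (hT.comp measurable_snd))
    refine Integrable.of_bound hm.aestronglyMeasurable (∑ s : I × I, ‖F s.1 s.2‖)
      (Eventually.of_forall fun z => ?_)
    exact Finset.single_le_sum (f := fun s : I × I => ‖F s.1 s.2‖) (fun _ _ => norm_nonneg _)
      (Finset.mem_univ (T z.1, T z.2))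
  change ∫ z, F (T z.1) (T z.2) ∂(∑ z, ENNReal.ofReal (w z) • (P z.1).prod (Q z.2)) = _
  rw [integral_finsetSum_measure (fun z _ => (hint _ inferInstance).smul_measure
    ENNReal.ofReal_ne_top)]
  refine Finset.sum_congr rfl fun z _ => ?_
  rw [integral_smul_measure, ENNReal.toReal_ofReal (hw z), smul_eq_mul]
  by_cases hz : w z = 0
  · simp [hz]
  congr 1
  have i1 := ProbabilityTheory.cond_isProbabilityMeasure (hpos1 z hz)
  have i2 := ProbabilityTheory.cond_isProbabilityMeasure (hpos2 z hz)
  have hae : (fun s : X × X => F (T s.1) (T s.2)) =ᵐ[(P z.1).prod (Q z.2)]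
      fun _ => F z.1 z.2 := by
    have e1 : ∀ᵐ s ∂(P z.1).prod (Q z.2), s.1 ∈ T ⁻¹' {z.1} :=
      Measure.quasiMeasurePreserving_fst.ae
        (ProbabilityTheory.ae_cond_mem (hT (measurableSet_singleton _)))
    have e2 : ∀ᵐ s ∂(P z.1).prod (Q z.2), s.2 ∈ T ⁻¹' {z.2} :=
      Measure.quasiMeasurePreserving_snd.ae
        (ProbabilityTheory.ae_cond_mem (hT (measurableSet_singleton _)))
    filter_upwards [e1, e2] with s h1 h2
    simp only [Set.mem_preimage, Set.mem_singleton_iff] at h1 h2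
    rw [h1, h2]
  rw [integral_congr_ae hae]
  have i3 : IsProbabilityMeasure (P z.1) := i1
  have i4 : IsProbabilityMeasure (Q z.2) := i2
  simp

end Coupling

/-! ### Nonexpansive functions -/

/-- The `[0, 1]`-valued functions that are nonexpansive for `k`. -/
structure Nonexpansive {X : Type*} (k : X → X → ℝ) (h : X → ℝ) : Prop where
  sub_le : ∀ x y, h x - h y ≤ k x y
  nonneg : ∀ x, 0 ≤ h x
  le_one : ∀ x, h x ≤ 1

section Nonexpansive

variable {X : Type*} {k : X → X → ℝ} {h : X → ℝ}

theorem Nonexpansive.mono (hh : Nonexpansive k h) {k' : X → X → ℝ} (hk : ∀ x y, k x y ≤ k' x y) :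
    Nonexpansive k' h :=
  ⟨fun x y => (hh.sub_le x y).trans (hk x y), hh.nonneg, hh.le_one⟩

theorem IsPseudometric.abs_sub_le (hk : IsPseudometric k) (hh : ∀ x y, h x - h y ≤ k x y)
    (x y : X) : |h x - h y| ≤ k x y :=
  abs_sub_le_iff.2 ⟨hh x y, (hk.symm x y).symm ▸ hh y x⟩

theorem Nonexpansive.one_sub (hk : IsPseudometric k) (hh : Nonexpansive k h) :
    Nonexpansive k fun x => 1 - h x :=
  ⟨fun x y => by linarith [hh.sub_le y x, hk.symm x y], fun x => by linarith [hh.le_one x],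
    fun x => by linarith [hh.nonneg x]⟩

variable [TopologicalSpace X]

theorem IsPseudometric.tendsto_nhds_zero (hk : IsPseudometric k)
    (hkc : Continuous fun p : X × X => k p.1 p.2) (x : X) : Tendsto (k x) (𝓝 x) (𝓝 0) := by
  have h : Continuous (k x) := hkc.comp (by fun_prop : Continuous fun y : X => (x, y))
  simpa [hk.self x] using h.tendsto x

theorem IsPseudometric.continuous_of_sub_le (hk : IsPseudometric k)
    (hkc : Continuous fun p : X × X => k p.1 p.2) (hh : ∀ x y, h x - h y ≤ k x y) :
    Continuous h := by
  refine continuous_iff_continuousAt.2 fun x => tendsto_iff_dist_tendsto_zero.2 ?_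
  refine squeeze_zero (fun _ => dist_nonneg) (fun y => ?_) (hk.tendsto_nhds_zero hkc x)
  rw [Real.dist_eq, hk.symm]
  exact hk.abs_sub_le hh y x

/-- By the triangle inequality, `k` varies by at most the distances moved by its two arguments, so
continuity need only be checked at the diagonal. -/
theorem IsPseudometric.continuous_of_tendsto (hk : IsPseudometric k)
    (h0 : ∀ x, Tendsto (k x) (𝓝 x) (𝓝 0)) : Continuous fun p : X × X => k p.1 p.2 := by
  refine continuous_iff_continuousAt.2 fun ⟨x, y⟩ => tendsto_iff_dist_tendsto_zero.2 ?_
  have hs : Tendsto (fun p : X × X => k x p.1 + k y p.2) (𝓝 (x, y)) (𝓝 (0 + 0)) :=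
    ((h0 x).comp (continuous_fst.tendsto (x, y))).add
      ((h0 y).comp (continuous_snd.tendsto (x, y)))
  rw [add_zero] at hs
  refine squeeze_zero (fun _ => dist_nonneg) (fun p => ?_) hs
  rw [Real.dist_eq, abs_sub_le_iff]
  constructor
  · linarith [hk.triangle p.1 x p.2, hk.triangle x y p.2, hk.symm p.1 x]
  · linarith [hk.triangle x p.1 y, hk.triangle p.1 p.2 y, hk.symm p.2 y]

theorem Nonexpansive.continuous (hh : Nonexpansive k h) (hk : IsPseudometric k)
    (hkc : Continuous fun p : X × X => k p.1 p.2) : Continuous h :=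
  hk.continuous_of_sub_le hkc hh.sub_le

variable [MeasurableSpace X] [BorelSpace X]

theorem integrable_of_continuous_of_mem (μ : ProbabilityMeasure X) (hc : Continuous h)
    (h0 : ∀ x, 0 ≤ h x) (h1 : ∀ x, h x ≤ 1) : Integrable h (μ : Measure X) :=
  Integrable.of_bound hc.measurable.aestronglyMeasurable 1
    (Eventually.of_forall fun x => by rw [Real.norm_eq_abs, abs_of_nonneg (h0 x)]; exact h1 x)

theorem Nonexpansive.integrable (hh : Nonexpansive k h) (hk : IsPseudometric k)
    (hkc : Continuous fun p : X × X => k p.1 p.2) (μ : ProbabilityMeasure X) :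
    Integrable h (μ : Measure X) :=
  integrable_of_continuous_of_mem μ (hh.continuous hk hkc) hh.nonneg hh.le_one

theorem continuous_integral_of_mem (hc : Continuous h) (h0 : ∀ x, 0 ≤ h x) (h1 : ∀ x, h x ≤ 1) :
    Continuous fun μ : ProbabilityMeasure X => ∫ x, h x ∂(μ : Measure X) :=
  ProbabilityMeasure.continuous_integral_boundedContinuousFunction
    (BoundedContinuousFunction.ofNormedAddCommGroup h hc 1
      fun x => by rw [Real.norm_eq_abs, abs_of_nonneg (h0 x)]; exact h1 x)

end Nonexpansive

/-! ### Duality for continuous pseudometrics -/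

section Duality

variable {X : Type*} {k : X → X → ℝ} [MeasurableSpace X]

theorem integral_comp_fst_of_mem_couplings {μ ν : ProbabilityMeasure X}
    {γ : ProbabilityMeasure (X × X)} (hγ : γ ∈ couplings μ ν) {f : X → ℝ} (hf : Measurable f) :
    ∫ z, f z.1 ∂(γ : Measure (X × X)) = ∫ x, f x ∂(μ : Measure X) := by
  rw [← hγ.1, integral_map measurable_fst.aemeasurable hf.aestronglyMeasurable]

theorem integral_comp_snd_of_mem_couplings {μ ν : ProbabilityMeasure X}
    {γ : ProbabilityMeasure (X × X)} (hγ : γ ∈ couplings μ ν) {f : X → ℝ} (hf : Measurable f) :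
    ∫ z, f z.2 ∂(γ : Measure (X × X)) = ∫ x, f x ∂(ν : Measure X) := by
  rw [← hγ.2, integral_map measurable_snd.aemeasurable hf.aestronglyMeasurable]

theorem integrable_of_measurable_of_mem {Y : Type*} [MeasurableSpace Y] {m : Measure Y}
    [IsFiniteMeasure m] {f : Y → ℝ} (hf : Measurable f) (h0 : ∀ y, 0 ≤ f y) (h1 : ∀ y, f y ≤ 1) :
    Integrable f m :=
  Integrable.of_bound hf.aestronglyMeasurable 1
    (Eventually.of_forall fun x => by rw [Real.norm_eq_abs, abs_of_nonneg (h0 x)]; exact h1 x)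

theorem transportCost_le (hk : IsPseudometric k) {μ ν : ProbabilityMeasure X}
    {γ : ProbabilityMeasure (X × X)} (hγ : γ ∈ couplings μ ν) :
    transportCost k μ ν ≤ ∫ z, k z.1 z.2 ∂(γ : Measure (X × X)) :=
  ciInf_le (f := fun γ : couplings μ ν =>
    ∫ p, k p.1 p.2 ∂((γ : ProbabilityMeasure (X × X)) : Measure (X × X)))
    ⟨0, by rintro _ ⟨γ, rfl⟩; exact integral_nonneg fun z => hk.nonneg _ _⟩ ⟨γ, hγ⟩

theorem couplings_nonempty (μ ν : ProbabilityMeasure X) : (couplings μ ν).Nonempty :=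
  ⟨⟨(μ : Measure X).prod (ν : Measure X), inferInstance⟩, by
    constructor <;> simp⟩

variable [TopologicalSpace X] [BorelSpace X] [SecondCountableTopology X]

/-- The easy half of duality: integrate `h x - h y ≤ k x y` against an arbitrary coupling. -/
theorem Nonexpansive.integral_sub_le_transportCost {h : X → ℝ} (hh : Nonexpansive k h)
    (hk : IsPseudometric k) (hkc : Continuous fun p : X × X => k p.1 p.2)
    (μ ν : ProbabilityMeasure X) :
    ∫ x, h x ∂(μ : Measure X) - ∫ x, h x ∂(ν : Measure X) ≤ transportCost k μ ν := by
  have := (couplings_nonempty μ ν).to_subtype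
  refine le_ciInf fun γ => ?_
  have hm := (hh.continuous hk hkc).measurable
  have i1 : Integrable (fun z : X × X => h z.1) ((γ : ProbabilityMeasure (X × X)) :
      Measure (X × X)) := integrable_of_measurable_of_mem (hm.comp measurable_fst)
    (fun _ => hh.nonneg _) fun _ => hh.le_one _
  have i2 : Integrable (fun z : X × X => h z.2) ((γ : ProbabilityMeasure (X × X)) :
      Measure (X × X)) := integrable_of_measurable_of_mem (hm.comp measurable_snd)
    (fun _ => hh.nonneg _) fun _ => hh.le_one _
  rw [← integral_comp_fst_of_mem_couplings γ.2 hm, ← integral_comp_snd_of_mem_couplings γ.2 hm,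
    ← integral_sub i1 i2]
  exact integral_mono (i1.sub i2)
    (integrable_of_measurable_of_mem hkc.measurable (fun _ => hk.nonneg _ _)
      fun _ => hk.le_one _ _) fun z => hh.sub_le _ _

/-- Two measures can be quantized simultaneously by a finite-valued measurable map. -/
theorem exists_quantization (hk : IsPseudometric k)
    (hkc : Continuous fun p : X × X => k p.1 p.2) (μ ν : ProbabilityMeasure X) {ε : ℝ}
    (hε : 0 < ε) :
    ∃ (N : ℕ) (T : X → Fin (N + 1)) (a : Fin (N + 1) → X), Measurable T ∧
      ∫ x, k x (a (T x)) ∂(μ : Measure X) ≤ ε ∧ ∫ x, k x (a (T x)) ∂(ν : Measure X) ≤ ε := by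
  classical
  have hne : Nonempty X := nonempty_of_isProbabilityMeasure (μ : Measure X)
  let a := TopologicalSpace.denseSeq X
  have hex : ∀ x, ∃ i, k x (a i) < ε / 2 := by
    intro x
    have hopen : ∀ᶠ y in 𝓝 x, k x y < ε / 2 :=
      (hk.tendsto_nhds_zero hkc x).eventually (gt_mem_nhds (half_pos hε))
    obtain ⟨_, ⟨i, rfl⟩, hy⟩ :=
      (TopologicalSpace.denseRange_denseSeq X).inter_nhds_nonempty hopen
    exact ⟨i, hy⟩
  have hka : ∀ i, Measurable fun x => k x (a i) := fun i =>
    (hkc.comp (by fun_prop : Continuous fun x : X => (x, a i))).measurable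
  -- Index of the first point of the dense sequence within `ε / 2`. Capping it at `N` makes it
  -- finite-valued; since `k ≤ 1`, dominated convergence makes the error of the cap small for both
  -- measures at once.
  let T : X → ℕ := fun x => Nat.find (hex x)
  have hT : Measurable T := measurable_find hex fun i => measurableSet_lt (hka i) measurable_const
  have hmin : ∀ N, Measurable fun x => k x (a (min (T x) N)) := fun N => by
    have : Measurable fun p : ℕ × X => k p.2 (a p.1) := measurable_from_prod_countable_right hka
    exact this.comp ((hT.min measurable_const).prodMk measurable_id)
  have hlim : ∀ m : ProbabilityMeasure X,
      ∀ᶠ N in atTop, ∫ x, k x (a (min (T x) N)) ∂(m : Measure X) ≤ ε := by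
    intro m
    have h1 : Tendsto (fun N => ∫ x, k x (a (min (T x) N)) ∂(m : Measure X)) atTop
        (𝓝 (∫ x, k x (a (T x)) ∂(m : Measure X))) := by
      refine tendsto_integral_of_dominated_convergence (fun _ => 1)
        (fun N => (hmin N).aestronglyMeasurable) (integrable_const _)
        (fun N => Eventually.of_forall fun x => ?_) (Eventually.of_forall fun x => ?_)
      · rw [Real.norm_eq_abs, abs_of_nonneg (hk.nonneg _ _)]
        exact hk.le_one _ _
      · refine tendsto_const_nhds.congr' ?_
        filter_upwards [eventually_ge_atTop (T x)] with N hN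
        rw [min_eq_left hN]
    have h2 : ∫ x, k x (a (T x)) ∂(m : Measure X) ≤ ε / 2 := by
      have := integral_mono_of_nonneg (μ := (m : Measure X)) (f := fun x => k x (a (T x)))
        (g := fun _ => ε / 2) (Eventually.of_forall fun x => hk.nonneg _ _) (integrable_const _)
        (Eventually.of_forall fun x => (Nat.find_spec (hex x)).le)
      simpa using this
    filter_upwards [h1.eventually (gt_mem_nhds (h2.trans_lt (half_lt_self hε)))] with N hN
    exact hN.le
  obtain ⟨N, h1, h2⟩ := ((hlim μ).and (hlim ν)).exists
  exact ⟨N, fun x => ⟨min (T x) N, by omega⟩, fun i => a i,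
    (measurable_from_nat (f := fun n : ℕ => (⟨min n N, by omega⟩ : Fin (N + 1)))).comp hT, h1, h2⟩

/-- Transport duality, up to `ε`. -/
theorem exists_nonexpansive_transportCost_le (hk : IsPseudometric k)
    (hkc : Continuous fun p : X × X => k p.1 p.2) (μ ν : ProbabilityMeasure X) {ε : ℝ}
    (hε : 0 < ε) :
    ∃ h, Nonexpansive k h ∧
      transportCost k μ ν ≤ ∫ x, h x ∂(μ : Measure X) - ∫ x, h x ∂(ν : Measure X) + ε := by
  by_contra! hcon
  have hne : Nonempty X := nonempty_of_isProbabilityMeasure (μ : Measure X)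
  obtain ⟨N, T, a, hT, hμ, hν⟩ := exists_quantization hk hkc μ ν (ε := ε / 8) (by positivity)
  set W := transportCost k μ ν
  have hkT : Measurable fun x => k x (a (T x)) :=
    (measurable_from_prod_countable_right (f := fun p : Fin (N + 1) × X => k p.2 (a p.1))
      fun i => (hkc.comp (by fun_prop : Continuous fun x : X => (x, a i))).measurable).comp
      (hT.prodMk measurable_id)
  have hkTi : ∀ m : ProbabilityMeasure X, Integrable (fun x => k x (a (T x))) (m : Measure X) :=
    fun m => integrable_of_measurable_of_mem hkT (fun _ => hk.nonneg _ _) fun _ => hk.le_one _ _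
  -- The negated claim gives each potential value less than `W - ε`, and quantization costs `ε / 8`
  -- per marginal, hence the dual bound `W - 3 / 4 * ε`. Lifting the plan costs `ε / 8` per marginal
  -- again, so a coupling of cost at most `W - ε / 2` appears.
  obtain ⟨w, hw, hw1, hw2, hwS⟩ := exists_plan_of_dual_le (fun i j => k (a i) (a j))
    (real_preimage_mem_stdSimplex μ hT) (real_preimage_mem_stdSimplex ν hT) (S := W - 3 / 4 * ε) (by
      intro A B hAB
      rw [← integral_comp_eq_sum μ hT, ← integral_comp_eq_sum ν hT]
      -- The `k`-transform of `B`: an infimum of nonexpansive functions, lying above `A` and below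
      -- `-B` at the points `a i`. One function thus replaces both potentials.
      let φ : X → ℝ := fun x => Finset.univ.inf' Finset.univ_nonempty fun j => k x (a j) - B j
      have hφ : ∀ x y, φ x - φ y ≤ k x y := by
        intro x y
        obtain ⟨j, -, hj⟩ := Finset.exists_mem_eq_inf' Finset.univ_nonempty fun j => k y (a j) - B j
        have h1 : φ x ≤ k x (a j) - B j := Finset.inf'_le _ (Finset.mem_univ j)
        have h2 : φ y = k y (a j) - B j := hj
        linarith [hk.triangle x y (a j)]
      have hφc := hk.continuous_of_sub_le hkc hφ
      have hA : ∀ i, A i ≤ φ (a i) := fun i =>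
        Finset.le_inf' _ _ fun j _ => by linarith [hAB i j]
      have hB : ∀ j, φ (a j) ≤ - B j := fun j =>
        (Finset.inf'_le _ (Finset.mem_univ j)).trans (by simp [hk.self])
      let x₀ := hne.some
      have hbdd : BddBelow (Set.range φ) := ⟨φ x₀ - 1, by
        rintro _ ⟨x, rfl⟩
        linarith [hφ x₀ x, hk.le_one x₀ x]⟩
      -- As `k ≤ 1`, `φ` oscillates by at most one, so subtracting its infimum puts it in `[0, 1]`;
      -- the constant cancels between the two integrals.
      have hφh : Nonexpansive k fun x => φ x - ⨅ y, φ y := by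
        refine ⟨fun x y => by linarith [hφ x y], fun x => sub_nonneg.2 (ciInf_le hbdd x),
          fun x => ?_⟩
        have : φ x - 1 ≤ ⨅ y, φ y := le_ciInf fun y => by linarith [hφ x y, hk.le_one x y]
        linarith
      have hφi : ∀ m : ProbabilityMeasure X, Integrable φ (m : Measure X) := fun m => by
        have := (hφh.integrable hk hkc m).add (integrable_const (⨅ y, φ y))
        refine this.congr (Eventually.of_forall fun x => ?_)
        simp
      have hfin : ∀ (m : ProbabilityMeasure X) (f : Fin (N + 1) → ℝ),
          Integrable (fun x => f (T x)) (m : Measure X) := fun m f =>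
        Integrable.of_bound ((measurable_of_finite f).comp hT).aestronglyMeasurable
          (∑ i, ‖f i‖) (Eventually.of_forall fun x =>
            Finset.single_le_sum (f := fun i => ‖f i‖) (fun _ _ => norm_nonneg _)
              (Finset.mem_univ (T x)))
      have h1 : ∫ x, A (T x) ∂(μ : Measure X) ≤ ∫ x, φ x ∂(μ : Measure X) + ε / 8 := by
        refine le_trans ?_ (add_le_add_right hμ _)
        rw [← integral_add (hφi μ) (hkTi μ)]
        refine integral_mono (hfin μ A) ((hφi μ).add (hkTi μ)) fun x => ?_
        change A (T x) ≤ φ x + k x (a (T x))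
        linarith [hA (T x), hφ (a (T x)) x, hk.symm x (a (T x))]
      have h2 : ∫ x, B (T x) ∂(ν : Measure X) ≤ - ∫ x, φ x ∂(ν : Measure X) + ε / 8 := by
        refine le_trans ?_ (add_le_add_right hν _)
        have hneg : Integrable (fun x => - φ x) (ν : Measure X) := (hφi ν).neg
        rw [← integral_neg, ← integral_add hneg (hkTi ν)]
        refine integral_mono (hfin ν B) ((hφi ν).neg.add (hkTi ν)) fun x => ?_
        change B (T x) ≤ - φ x + k x (a (T x))
        linarith [hB (T x), hφ x (a (T x))]
      have h3 := hcon _ hφh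
      rw [integral_sub (hφi μ) (integrable_const _), integral_sub (hφi ν) (integrable_const _)] at h3
      simp only [integral_const, probReal_univ, smul_eq_mul, one_mul] at h3
      linarith)
  obtain ⟨γ, hγ, hF⟩ := exists_coupling_of_plan μ ν hT hw hw1 hw2
  have hcost := transportCost_le hk hγ
  have i1 : Integrable (fun z : X × X => k z.1 (a (T z.1))) (γ : Measure (X × X)) :=
    integrable_of_measurable_of_mem (hkT.comp measurable_fst) (fun _ => hk.nonneg _ _)
      fun _ => hk.le_one _ _
  have i2 : Integrable (fun z : X × X => k (a (T z.1)) (a (T z.2))) (γ : Measure (X × X)) :=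
    integrable_of_measurable_of_mem
      ((measurable_of_finite fun s : Fin (N + 1) × Fin (N + 1) => k (a s.1) (a s.2)).comp
        ((hT.comp measurable_fst).prodMk (hT.comp measurable_snd))) (fun _ => hk.nonneg _ _)
      fun _ => hk.le_one _ _
  have i3 : Integrable (fun z : X × X => k z.2 (a (T z.2))) (γ : Measure (X × X)) :=
    integrable_of_measurable_of_mem (hkT.comp measurable_snd) (fun _ => hk.nonneg _ _)
      fun _ => hk.le_one _ _
  have i12 : Integrable (fun z : X × X => k z.1 (a (T z.1)) + k (a (T z.1)) (a (T z.2)))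
    (γ : Measure (X × X)) := i1.add i2
  have hle : ∫ z, k z.1 z.2 ∂(γ : Measure (X × X)) ≤
      ∫ z, (k z.1 (a (T z.1)) + k (a (T z.1)) (a (T z.2)) + k z.2 (a (T z.2)))
        ∂(γ : Measure (X × X)) := by
    refine integral_mono (integrable_of_measurable_of_mem hkc.measurable (fun _ => hk.nonneg _ _)
      fun _ => hk.le_one _ _) (i12.add i3) fun z => ?_
    change k z.1 z.2 ≤ k z.1 (a (T z.1)) + k (a (T z.1)) (a (T z.2)) + k z.2 (a (T z.2))
    linarith [hk.triangle z.1 (a (T z.1)) z.2, hk.triangle (a (T z.1)) (a (T z.2)) z.2,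
      hk.symm (a (T z.2)) z.2]
  rw [integral_add i12 i3, integral_add i1 i2, hF fun i j => k (a i) (a j),
    integral_comp_fst_of_mem_couplings hγ hkT, integral_comp_snd_of_mem_couplings hγ hkT] at hle
  linarith

/-- The transport cost of a continuous pseudometric is a pseudometric. -/
theorem IsPseudometric.transportCost (hk : IsPseudometric k)
    (hkc : Continuous fun p : X × X => k p.1 p.2) :
    IsPseudometric (fun μ ν : ProbabilityMeasure X => TrajMetric.transportCost k μ ν) := by
  have hsymm : ∀ μ ν : ProbabilityMeasure X,
      TrajMetric.transportCost k μ ν ≤ TrajMetric.transportCost k ν μ := by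
    intro μ ν
    refine le_of_forall_pos_le_add fun ε hε => ?_
    obtain ⟨h, hh, hle⟩ := exists_nonexpansive_transportCost_le hk hkc μ ν hε
    have h1 := (hh.one_sub hk).integral_sub_le_transportCost hk hkc ν μ
    rw [integral_sub (integrable_const _) (hh.integrable hk hkc _),
      integral_sub (integrable_const _) (hh.integrable hk hkc _)] at h1
    simp only [integral_const, probReal_univ, smul_eq_mul, one_mul] at h1
    linarith
  have hnonneg : ∀ μ ν : ProbabilityMeasure X, 0 ≤ TrajMetric.transportCost k μ ν := fun μ ν =>
    Real.iInf_nonneg fun γ => integral_nonneg fun z => hk.nonneg _ _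
  refine ⟨hnonneg, fun μ ν => ?_, fun μ => ?_, fun μ ν => le_antisymm (hsymm _ _) (hsymm _ _),
    fun μ ν ρ => ?_⟩
  · refine le_of_forall_pos_le_add fun ε hε => ?_
    obtain ⟨h, hh, hle⟩ := exists_nonexpansive_transportCost_le hk hkc μ ν hε
    have h1 : ∫ x, h x ∂(μ : Measure X) ≤ 1 := by
      have := integral_mono (hh.integrable hk hkc μ) (integrable_const 1) hh.le_one
      simpa using this
    have h2 : 0 ≤ ∫ x, h x ∂(ν : Measure X) := integral_nonneg hh.nonneg
    linarith
  · refine le_antisymm (le_of_forall_pos_le_add fun ε hε => ?_) (hnonneg μ μ)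
    obtain ⟨h, hh, hle⟩ := exists_nonexpansive_transportCost_le hk hkc μ μ hε
    linarith
  -- A single potential for `(μ, ρ)` is tested on `(μ, ν)` and `(ν, ρ)`, which replaces the gluing
  -- of couplings.
  · refine le_of_forall_pos_le_add fun ε hε => ?_
    obtain ⟨h, hh, hle⟩ := exists_nonexpansive_transportCost_le hk hkc μ ρ hε
    linarith [hh.integral_sub_le_transportCost hk hkc μ ν,
      hh.integral_sub_le_transportCost hk hkc ν ρ]

theorem transportCost_mono {k' : X → X → ℝ} (hk : IsPseudometric k)
    (hkc : Continuous fun p : X × X => k p.1 p.2) (hk' : IsPseudometric k')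
    (hkc' : Continuous fun p : X × X => k' p.1 p.2) (hle : ∀ x y, k x y ≤ k' x y)
    (μ ν : ProbabilityMeasure X) : transportCost k μ ν ≤ transportCost k' μ ν := by
  refine le_of_forall_pos_le_add fun ε hε => ?_
  obtain ⟨h, hh, h1⟩ := exists_nonexpansive_transportCost_le hk hkc μ ν hε
  linarith [(hh.mono hle).integral_sub_le_transportCost hk' hkc' μ ν]

/-! ### Weak continuity of the transport cost -/

/-- A measure is approximately concentrated on a finite union of `k`-balls, with a continuous
partition of unity subordinate to these balls. -/
theorem exists_partition (hk : IsPseudometric k) (hkc : Continuous fun p : X × X => k p.1 p.2)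
    (μ : ProbabilityMeasure X) {ε : ℝ} (hε : 0 < ε) :
    ∃ (N : ℕ) (a : ℕ → X) (χ : ℕ → X → ℝ), (∀ i, Continuous (χ i)) ∧ (∀ i x, 0 ≤ χ i x) ∧
      (∀ x, ∑ i ∈ Finset.range N, χ i x ≤ 1) ∧ (∀ i x, χ i x ≠ 0 → k x (a i) ≤ ε) ∧
      1 - ε < ∫ x, ∑ i ∈ Finset.range N, χ i x ∂(μ : Measure X) := by
  have hne : Nonempty X := nonempty_of_isProbabilityMeasure (μ : Measure X)
  let a := TopologicalSpace.denseSeq X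
  let ψ : ℕ → X → ℝ := fun i x => max 0 (1 - k x (a i) / ε)
  have hψc : ∀ i, Continuous (ψ i) := fun i => continuous_const.max (continuous_const.sub
    ((hkc.comp (by fun_prop : Continuous fun x : X => (x, a i))).div_const ε))
  -- Running maximum of the first `N` bumps. Its increments are the `χ i`; they telescope to `M N`,
  -- which increases to `1` by density of the centres.
  let M : ℕ → X → ℝ := fun N => N.rec (fun _ => 0) fun n f x => max (f x) (ψ n x)
  have hMs : ∀ n x, M (n + 1) x = max (M n x) (ψ n x) := fun _ _ => rfl
  have hMc : ∀ n, Continuous (M n) := fun n => by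
    induction n with
    | zero => exact continuous_const
    | succ n ih => exact ih.max (hψc n)
  have hM0 : ∀ n x, 0 ≤ M n x := fun n x => by
    induction n with
    | zero => exact le_rfl
    | succ n ih => exact ih.trans (le_max_left _ _)
  have hψ1 : ∀ i x, ψ i x ≤ 1 := fun i x => max_le zero_le_one
    (by linarith [div_nonneg (hk.nonneg x (a i)) hε.le])
  have hM1 : ∀ n x, M n x ≤ 1 := fun n x => by
    induction n with
    | zero => exact zero_le_one
    | succ n ih => exact max_le ih (hψ1 n x)
  have hmono : ∀ x, Monotone fun n => M n x := fun x =>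
    monotone_nat_of_le_succ fun n => le_max_left _ _
  have hlim : ∀ x, Tendsto (fun n => M n x) atTop (𝓝 1) := by
    intro x
    refine tendsto_order.2 ⟨fun b hb => ?_, fun b hb =>
      Eventually.of_forall fun n => (hM1 n x).trans_lt hb⟩
    have hopen : ∀ᶠ y in 𝓝 x, k x y < (1 - b) * ε :=
      (hk.tendsto_nhds_zero hkc x).eventually (gt_mem_nhds (mul_pos (sub_pos.2 hb) hε))
    obtain ⟨_, ⟨i, rfl⟩, hy⟩ :=
      (TopologicalSpace.denseRange_denseSeq X).inter_nhds_nonempty hopen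
    have hi : b < ψ i x := by
      refine lt_of_lt_of_le ?_ (le_max_right _ _)
      have : k x (a i) / ε < 1 - b := (div_lt_iff₀ hε).2 hy
      linarith
    filter_upwards [eventually_ge_atTop (i + 1)] with n hn
    exact (hi.trans_le (le_max_right _ _)).trans_le (hmono x hn)
  have hint : Tendsto (fun n => ∫ x, M n x ∂(μ : Measure X)) atTop (𝓝 1) := by
    have h := tendsto_integral_of_dominated_convergence (μ := (μ : Measure X)) (F := M)
      (f := fun _ => 1) (fun _ => (1 : ℝ)) (fun n => (hMc n).measurable.aestronglyMeasurable)
      (integrable_const _) (fun n => Eventually.of_forall fun x => by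
        rw [Real.norm_eq_abs, abs_of_nonneg (hM0 n x)]
        exact hM1 n x) (Eventually.of_forall hlim)
    simpa using h
  obtain ⟨N, hN⟩ := (hint.eventually (lt_mem_nhds (sub_lt_self 1 hε))).exists
  have hsum : ∀ x, ∑ i ∈ Finset.range N, (M (i + 1) x - M i x) = M N x := fun x => by
    rw [Finset.sum_range_sub (fun n => M n x)]
    exact sub_zero _
  refine ⟨N, a, fun i x => M (i + 1) x - M i x, fun i => (hMc (i + 1)).sub (hMc i),
    fun i x => sub_nonneg.2 (le_max_left _ _), fun x => ?_, fun i x hx => ?_, ?_⟩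
  · rw [hsum]
    exact hM1 N x
  · by_contra! hlt
    refine hx (sub_eq_zero.2 (max_eq_left ?_))
    refine (max_le le_rfl ?_).trans (hM0 i x)
    have : 1 < k x (a i) / ε := (one_lt_div hε).2 hlt
    linarith
  · simpa only [hsum] using hN

/-- The dual potential `h` depends on `ν`, so weak convergence must be used uniformly over
nonexpansive `h`. Each is close to `∑ h (a i) * χ i`, with an error independent of `h`, so control
of finitely many integrals of the fixed `χ i` suffices. -/
theorem tendsto_transportCost (hk : IsPseudometric k)
    (hkc : Continuous fun p : X × X => k p.1 p.2) (μ : ProbabilityMeasure X) :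
    Tendsto (TrajMetric.transportCost k μ) (𝓝 μ) (𝓝 0) := by
  refine tendsto_order.2 ⟨fun b hb => Eventually.of_forall fun ν =>
    hb.trans_le ((hk.transportCost hkc).nonneg μ ν), fun b hb => ?_⟩
  -- The budget is `2 * ε` for approximating `h` under each measure, `ε` for the integrals of the `χ
  -- i`, and `ε` for duality.
  set ε := b / 6 with hεb
  have hε : 0 < ε := by positivity
  obtain ⟨N, a, χ, hχc, hχ0, hχ1, hχk, hχμ⟩ := exists_partition hk hkc μ hε
  have hχ1' : ∀ i ∈ Finset.range N, ∀ x, χ i x ≤ 1 := fun i hi x =>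
    (Finset.single_le_sum (f := fun i => χ i x) (fun _ _ => hχ0 _ _) hi).trans (hχ1 x)
  have hMc : Continuous fun x => ∑ i ∈ Finset.range N, χ i x :=
    continuous_finsetSum _ fun i _ => hχc i
  have hM0 : ∀ x, 0 ≤ ∑ i ∈ Finset.range N, χ i x := fun x =>
    Finset.sum_nonneg fun _ _ => hχ0 _ _
  have e1 : ∀ᶠ ν : ProbabilityMeasure X in 𝓝 μ,
      1 - ε < ∫ x, ∑ i ∈ Finset.range N, χ i x ∂(ν : Measure X) :=
    (continuous_integral_of_mem hMc hM0 hχ1).continuousAt.eventually (lt_mem_nhds hχμ)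
  have e2 : ∀ᶠ ν : ProbabilityMeasure X in 𝓝 μ,
      ∑ i ∈ Finset.range N, |∫ x, χ i x ∂(μ : Measure X) - ∫ x, χ i x ∂(ν : Measure X)| < ε := by
    have hc : Continuous fun ν : ProbabilityMeasure X =>
        ∑ i ∈ Finset.range N, |∫ x, χ i x ∂(μ : Measure X) - ∫ x, χ i x ∂(ν : Measure X)| :=
      continuous_finsetSum _ fun i hi => (continuous_const.sub
        (continuous_integral_of_mem (hχc i) (hχ0 i) (hχ1' i hi))).abs
    exact hc.continuousAt.eventually (gt_mem_nhds (by simpa using hε))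
  filter_upwards [e1, e2] with ν h1 h2
  obtain ⟨h, hh, hle⟩ := exists_nonexpansive_transportCost_le hk hkc μ ν hε
  have hχi : ∀ m : ProbabilityMeasure X, ∀ i ∈ Finset.range N, Integrable (χ i) (m : Measure X) :=
    fun m i hi => integrable_of_continuous_of_mem m (hχc i) (hχ0 i) (hχ1' i hi)
  have hpt : ∀ x, |h x - ∑ i ∈ Finset.range N, h (a i) * χ i x| ≤
      ε + (1 - ∑ i ∈ Finset.range N, χ i x) := by
    intro x
    have hsplit : h x - ∑ i ∈ Finset.range N, h (a i) * χ i x =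
        ∑ i ∈ Finset.range N, (h x - h (a i)) * χ i x +
          h x * (1 - ∑ i ∈ Finset.range N, χ i x) := by
      simp only [sub_mul, Finset.sum_sub_distrib, ← Finset.mul_sum]
      ring
    have hb1 : |∑ i ∈ Finset.range N, (h x - h (a i)) * χ i x| ≤
        ∑ i ∈ Finset.range N, ε * χ i x := by
      refine (Finset.abs_sum_le_sum_abs _ _).trans (Finset.sum_le_sum fun i _ => ?_)
      rw [abs_mul, abs_of_nonneg (hχ0 i x)]
      by_cases hi : χ i x = 0
      · simp [hi]
      · exact mul_le_mul_of_nonneg_right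
          ((hk.abs_sub_le hh.sub_le _ _).trans (hχk i x hi)) (hχ0 i x)
    have hb2 : |h x * (1 - ∑ i ∈ Finset.range N, χ i x)| ≤ 1 - ∑ i ∈ Finset.range N, χ i x := by
      have := sub_nonneg.2 (hχ1 x)
      rw [abs_of_nonneg (mul_nonneg (hh.nonneg x) this)]
      exact mul_le_of_le_one_left this (hh.le_one x)
    rw [← Finset.mul_sum] at hb1
    have hb3 : ε * ∑ i ∈ Finset.range N, χ i x ≤ ε := mul_le_of_le_one_right hε.le (hχ1 x)
    rw [hsplit]
    exact (abs_add_le _ _).trans (by linarith)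
  have hint : ∀ m : ProbabilityMeasure X,
      1 - ε < ∫ x, ∑ i ∈ Finset.range N, χ i x ∂(m : Measure X) →
      |∫ x, h x ∂(m : Measure X) - ∑ i ∈ Finset.range N, h (a i) * ∫ x, χ i x ∂(m : Measure X)| ≤
        2 * ε := by
    intro m hm
    have hi1 : Integrable (fun x => ∑ i ∈ Finset.range N, h (a i) * χ i x) (m : Measure X) :=
      integrable_finsetSum _ fun i hi => (hχi m i hi).const_mul _
    have hi2 : Integrable (fun x => ∑ i ∈ Finset.range N, χ i x) (m : Measure X) :=
      integrable_finsetSum _ (hχi m)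
    have heq : ∑ i ∈ Finset.range N, h (a i) * ∫ x, χ i x ∂(m : Measure X) =
        ∫ x, ∑ i ∈ Finset.range N, h (a i) * χ i x ∂(m : Measure X) := by
      rw [integral_finsetSum _ fun i hi => (hχi m i hi).const_mul _]
      simp only [integral_const_mul]
    rw [heq, ← integral_sub (hh.integrable hk hkc m) hi1]
    refine (abs_integral_le_integral_abs).trans ((integral_mono
      ((hh.integrable hk hkc m).sub hi1).abs
      ((integrable_const ε).add ((integrable_const 1).sub hi2)) hpt).trans ?_)
    rw [integral_add' (integrable_const ε) ((integrable_const 1).sub hi2),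
      integral_sub' (integrable_const 1) hi2]
    simp only [integral_const, probReal_univ, smul_eq_mul, one_mul]
    linarith
  have hS : ∑ i ∈ Finset.range N, h (a i) * ∫ x, χ i x ∂(μ : Measure X) -
      ∑ i ∈ Finset.range N, h (a i) * ∫ x, χ i x ∂(ν : Measure X) ≤
      ∑ i ∈ Finset.range N, |∫ x, χ i x ∂(μ : Measure X) - ∫ x, χ i x ∂(ν : Measure X)| := by
    rw [← Finset.sum_sub_distrib]
    refine Finset.sum_le_sum fun i _ => ?_
    rw [← mul_sub]
    refine (le_abs_self _).trans ?_
    rw [abs_mul, abs_of_nonneg (hh.nonneg _)]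
    exact mul_le_of_le_one_left (abs_nonneg _) (hh.le_one _)
  have hμ := (abs_le.1 (hint μ hχμ)).2
  have hν := (abs_le.1 (hint ν h1)).1
  linarith

theorem continuous_transportCost (hk : IsPseudometric k)
    (hkc : Continuous fun p : X × X => k p.1 p.2) :
    Continuous fun p : ProbabilityMeasure X × ProbabilityMeasure X =>
      transportCost k p.1 p.2 :=
  (hk.transportCost hkc).continuous_of_tendsto fun μ => tendsto_transportCost hk hkc μ

end Duality

/-! ### Approximation in lattices of nonexpansive functions -/

/-- A lattice of nonexpansive functions that interpolates a nonexpansive function `h` at any two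
points contains a sequence that converges pointwise to `h`. -/
theorem exists_seq_tendsto_of_interpolation {X : Type*} [TopologicalSpace X]
    [SecondCountableTopology X] [Nonempty X] {k : X → X → ℝ} (hk : IsPseudometric k)
    (hkc : Continuous fun p : X × X => k p.1 p.2) {A : Set (X → ℝ)} (hsup : SupClosed A)
    (hinf : InfClosed A) (hA : ∀ g ∈ A, Nonexpansive k g) {h : X → ℝ} (hh : Nonexpansive k h)
    (hi : ∀ x y, ∀ ε > 0, ∃ g ∈ A, |g x - h x| ≤ ε ∧ |g y - h y| ≤ ε) :
    ∃ G : ℕ → X → ℝ, (∀ n, G n ∈ A) ∧ ∀ x, Tendsto (fun n => G n x) atTop (𝓝 (h x)) := by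
  let a := TopologicalSpace.denseSeq X
  have hpos : ∀ n : ℕ, (0 : ℝ) < 1 / ((n : ℝ) + 1) := fun n => by positivity
  choose g hgA hg1 hg2 using fun (n i j : ℕ) => hi (a i) (a j) _ (hpos n)
  have hne : ∀ n, (Finset.range (n + 1)).Nonempty := fun n => Finset.nonempty_range_add_one
  -- Max-min as in Stone-Weierstrass. At `a i`, the entry `j = i` bounds every row above by about `h
  -- (a i)`, while row `i` stays above about `h (a i)`.
  let G : ℕ → X → ℝ := fun n => (Finset.range (n + 1)).sup' (hne n) fun i =>
    (Finset.range (n + 1)).inf' (hne n) fun j => g n i j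
  have hGA : ∀ n, G n ∈ A := fun n =>
    hsup.finsetSup'_mem (hne n) fun i _ => hinf.finsetInf'_mem (hne n) fun j _ => hgA n i j
  have hdense : ∀ i n, i ≤ n → |G n (a i) - h (a i)| ≤ 1 / ((n : ℝ) + 1) := by
    intro i n hin
    have hmem : i ∈ Finset.range (n + 1) := Finset.mem_range.2 (Nat.lt_succ_of_le hin)
    simp only [G, Finset.sup'_apply, Finset.inf'_apply]
    rw [abs_sub_le_iff]
    constructor
    · rw [sub_le_iff_le_add]
      refine Finset.sup'_le _ _ fun l _ => (Finset.inf'_le _ hmem).trans ?_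
      linarith [(abs_le.1 (hg2 n l i)).2]
    · rw [sub_le_comm]
      refine le_trans ?_ (Finset.le_sup' (fun l => (Finset.range (n + 1)).inf' (hne n)
        fun j => g n l j (a i)) hmem)
      refine Finset.le_inf' _ _ fun j _ => ?_
      linarith [(abs_le.1 (hg1 n i j)).1]
  refine ⟨G, hGA, fun x => Metric.tendsto_atTop.2 fun ε hε => ?_⟩
  have hopen : ∀ᶠ y in 𝓝 x, k x y < ε / 3 :=
    (hk.tendsto_nhds_zero hkc x).eventually (gt_mem_nhds (by positivity))
  obtain ⟨_, ⟨i, rfl⟩, hy⟩ := (TopologicalSpace.denseRange_denseSeq X).inter_nhds_nonempty hopen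
  obtain ⟨m, hm⟩ := exists_nat_one_div_lt (show 0 < ε / 3 by positivity)
  -- `n ≥ i` brings `a i` into play and `n ≥ m` makes the interpolation error small;
  -- nonexpansiveness carries the estimate from `a i` to `x`.
  refine ⟨max i m, fun n hn => ?_⟩
  have hy' : k x (a i) < ε / 3 := hy
  have h1 := abs_le.1 (hk.abs_sub_le (hA _ (hGA n)).sub_le x (a i))
  have h2 := abs_le.1 (hk.abs_sub_le hh.sub_le x (a i))
  have h3 := abs_le.1 (hdense i n ((le_max_left _ _).trans hn))
  have h4 : 1 / ((n : ℝ) + 1) ≤ 1 / ((m : ℝ) + 1) :=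
    Nat.one_div_le_one_div ((le_max_right _ _).trans hn)
  rw [Real.dist_eq, abs_lt]
  constructor <;> linarith [h1.1, h1.2, h2.1, h2.2, h3.1, h3.2]

/-! ### The discounted uniform pseudometric -/

section DiscUnif

variable {E : Type*} [TopologicalSpace E] {c : ℝ} {m : E → E → ℝ}

theorem discount_nonneg (hc0 : 0 < c) (t : ℝ) : 0 ≤ c ^ t := Real.rpow_nonneg hc0.le _

theorem discount_le_one (hc0 : 0 < c) (hc1 : c < 1) (t : ℝ≥0) : c ^ (t : ℝ) ≤ 1 :=
  Real.rpow_le_one hc0.le hc1.le t.2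

theorem discUnif_term_le_one (hc0 : 0 < c) (hc1 : c < 1) (hm : IsPseudometric m)
    (ω ω' : Traj E) (t : ℝ≥0) : c ^ (t : ℝ) * m (ω t) (ω' t) ≤ 1 :=
  mul_le_one₀ (discount_le_one hc0 hc1 t) (hm.nonneg _ _) (hm.le_one _ _)

theorem le_discUnif (hc0 : 0 < c) (hc1 : c < 1) (hm : IsPseudometric m) (ω ω' : Traj E)
    (t : ℝ≥0) : c ^ (t : ℝ) * m (ω t) (ω' t) ≤ discUnif c m ω ω' :=
  le_ciSup (f := fun t : ℝ≥0 => c ^ (t : ℝ) * m (ω t) (ω' t))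
    ⟨1, by rintro _ ⟨t, rfl⟩; exact discUnif_term_le_one hc0 hc1 hm ω ω' t⟩ t

theorem discUnif_mono (hc0 : 0 < c) (hc1 : c < 1) {m' : E → E → ℝ}
    (hm' : IsPseudometric m') (h : ∀ x y, m x y ≤ m' x y) (ω ω' : Traj E) :
    discUnif c m ω ω' ≤ discUnif c m' ω ω' :=
  ciSup_le fun t => (mul_le_mul_of_nonneg_left (h _ _) (discount_nonneg hc0 _)).trans
    (le_discUnif hc0 hc1 hm' ω ω' t)

theorem IsPseudometric.discUnif (hc0 : 0 < c) (hc1 : c < 1) (hm : IsPseudometric m) :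
    IsPseudometric (TrajMetric.discUnif c m : Traj E → Traj E → ℝ) where
  nonneg ω ω' := Real.iSup_nonneg fun t => mul_nonneg (discount_nonneg hc0 _) (hm.nonneg _ _)
  le_one ω ω' := ciSup_le fun t => discUnif_term_le_one hc0 hc1 hm ω ω' t
  self ω := by simp [TrajMetric.discUnif, hm.self]
  symm ω ω' := by simp only [TrajMetric.discUnif, hm.symm]
  triangle ω₁ ω₂ ω₃ := ciSup_le fun t => by
    have h := mul_le_mul_of_nonneg_left (hm.triangle (ω₁ t) (ω₂ t) (ω₃ t))
      (discount_nonneg hc0 (t : ℝ))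
    linarith [le_discUnif hc0 hc1 hm ω₁ ω₂ t, le_discUnif hc0 hc1 hm ω₂ ω₃ t]

/-- Beyond a large time the discount alone makes the terms small, since `m ≤ 1`. Before it,
compactness of the time interval and joint continuity of evaluation give uniform smallness. -/
theorem continuous_discUnif (hc0 : 0 < c) (hc1 : c < 1) (hm : IsPseudometric m)
    (hmc : Continuous fun p : E × E => m p.1 p.2) :
    Continuous fun p : Traj E × Traj E => discUnif c m p.1 p.2 := by
  refine (hm.discUnif hc0 hc1).continuous_of_tendsto fun ω => ?_
  refine tendsto_order.2 ⟨fun b hb => Eventually.of_forall fun ω' =>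
    hb.trans_le ((hm.discUnif hc0 hc1).nonneg ω ω'), fun b hb => ?_⟩
  obtain ⟨N, hN⟩ := exists_pow_lt_of_lt_one (half_pos hb) hc1
  have hev : ∀ᶠ ω' in 𝓝 ω, ∀ t ∈ Set.Icc (0 : ℝ≥0) N, m (ω t) (ω' t) < b / 2 := by
    refine isCompact_Icc.eventually_forall_of_forall_eventually
      (P := fun (ω' : Traj E) t => m (ω t) (ω' t) < b / 2) fun t _ => ?_
    have hc : Continuous fun z : Traj E × ℝ≥0 => m (ω z.2) (z.1 z.2) :=
      hmc.comp ((ω.continuous.comp continuous_snd).prodMk continuous_eval)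
    refine hc.continuousAt.eventually (gt_mem_nhds ?_)
    simpa [hm.self] using half_pos hb
  filter_upwards [hev] with ω' hω'
  refine lt_of_le_of_lt (ciSup_le fun t => ?_) (half_lt_self hb)
  rcases le_total t (N : ℝ≥0) with ht | ht
  · exact (mul_le_of_le_one_left (hm.nonneg _ _) (discount_le_one hc0 hc1 t)).trans
      (hω' t ⟨zero_le, ht⟩).le
  · refine (mul_le_of_le_one_right (discount_nonneg hc0 _) (hm.le_one _ _)).trans
      (le_trans ?_ hN.le)
    rw [← Real.rpow_natCast]
    exact Real.rpow_le_rpow_of_exponent_ge hc0 hc1.le (by exact_mod_cast ht)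

theorem coe_nnratCast (q : ℚ≥0) : ((q : ℝ≥0) : ℝ) = (q : ℝ) := rfl

theorem exists_nnrat_lt_of_continuous {f : ℝ≥0 → ℝ} (hf : Continuous f) {b : ℝ} {t : ℝ≥0}
    (h : b < f t) : ∃ q : ℚ≥0, b < f (q : ℝ≥0) := by
  have hopen : {s | b < f s} ∈ 𝓝 t := (isOpen_lt continuous_const hf).mem_nhds h
  obtain ⟨u, htu, hu⟩ := exists_Ico_subset_of_mem_nhds hopen ⟨t + 1, lt_add_one t⟩
  obtain ⟨q, hq0, h1, h2⟩ := NNReal.lt_iff_exists_rat_btwn t u |>.1 htu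
  lift q to ℚ≥0 using hq0
  have hq : Real.toNNReal ((q : ℚ) : ℝ) = (q : ℝ≥0) := by
    ext
    rw [Real.coe_toNNReal _ (by exact_mod_cast q.2), coe_nnratCast]
    simp
  rw [hq] at h1 h2
  exact ⟨q, hu ⟨h1.le, h2⟩⟩

/-- Expressions evaluate only at rational times; continuity of trajectories makes these enough. -/
theorem exists_nnrat_lt_discUnif (hc0 : 0 < c) (hmc : Continuous fun p : E × E => m p.1 p.2)
    {ω ω' : Traj E} {b : ℝ} (h : b < discUnif c m ω ω') :
    ∃ q : ℚ≥0, b < c ^ (q : ℝ) * m (ω (q : ℝ≥0)) (ω' (q : ℝ≥0)) := by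
  obtain ⟨t, ht⟩ := exists_lt_of_lt_ciSup h
  have hc : Continuous fun t : ℝ≥0 => c ^ (t : ℝ) * m (ω t) (ω' t) :=
    (continuous_const.rpow NNReal.continuous_coe fun _ => Or.inl hc0.ne').mul
      (hmc.comp (ω.continuous.prodMk ω'.continuous))
  obtain ⟨q, hq⟩ := exists_nnrat_lt_of_continuous hc ht
  exact ⟨q, by rwa [coe_nnratCast] at hq⟩

end DiscUnif

theorem exists_unit_rat_near {x ε : ℝ} (h0 : 0 ≤ x) (h1 : x ≤ 1) (hε : 0 < ε) :
    ∃ q : Set.Icc (0 : ℚ) 1, |((q : ℚ) : ℝ) - x| ≤ ε := by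
  obtain ⟨q, hq1, hq2⟩ := exists_rat_btwn (show x - ε < x by linarith)
  refine ⟨⟨max 0 q, le_max_left _ _, max_le zero_le_one ?_⟩, ?_⟩
  · exact_mod_cast (hq2.trans_le h1).le
  · push_cast
    rw [abs_sub_le_iff]
    constructor
    · have := max_le h0 hq2.le
      linarith
    · linarith [le_max_right (0 : ℝ) q]

/-! ### The law at time zero -/

namespace Diffusion

variable {E : Type*} [TopologicalSpace E] [LocallyCompactSpace E] [T2Space E]
  [SecondCountableTopology E] [MeasurableSpace E] [BorelSpace E]

theorem law_start (D : Diffusion E) (x : E) : ∀ᵐ ω ∂(D.law x : Measure (Traj E)), ω 0 = x := by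
  have h := D.law_cylinder x {x} [] (measurableSet_singleton x) (by simp) List.Pairwise.nil
  have h1 : (D.law x : Measure (Traj E)) {ω | ω 0 = x} = 1 := by
    simpa [FDSemigroup.cylinderMass] using h
  exact (prob_compl_eq_zero_iff
    (Traj.measurable_eval 0 (measurableSet_singleton x))).2 h1

theorem integral_start (D : Diffusion E) (f : E → ℝ) (x : E) :
    ∫ ω, f (ω 0) ∂(D.law x : Measure (Traj E)) = f x := by
  have h : (fun ω : Traj E => f (ω 0)) =ᵐ[(D.law x : Measure (Traj E))] fun _ => f x := by
    filter_upwards [D.law_start x] with ω hω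
    rw [hω]
  rw [integral_congr_ae h]
  simp

/-! ### The iterates -/

theorem functionalG_isPseudometric (D : Diffusion E) {c : ℝ} (hc0 : 0 < c) (hc1 : c < 1)
    {m : E → E → ℝ} (hm : IsPseudometric m)
    (hmc : Continuous fun p : E × E => m p.1 p.2) :
    IsPseudometric (D.functionalG c m) ∧
      Continuous fun p : E × E => D.functionalG c m p.1 p.2 := by
  have hU := hm.discUnif hc0 hc1
  have hUc := continuous_discUnif hc0 hc1 hm hmc
  have hW := hU.transportCost hUc
  exact ⟨⟨fun _ _ => hW.nonneg _ _, fun _ _ => hW.le_one _ _, fun _ => hW.self _,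
    fun _ _ => hW.symm _ _, fun _ _ _ => hW.triangle _ _ _⟩,
    (continuous_transportCost hU hUc).comp ((D.continuous_law.comp continuous_fst).prodMk
      (D.continuous_law.comp continuous_snd))⟩

theorem iterDist_isPseudometric
    (D : Diffusion E) {obs : E → ℝ} (hobs : Continuous obs)
    (hobs01 : ∀ x, 0 ≤ obs x ∧ obs x ≤ 1) {c : ℝ} (hc0 : 0 < c) (hc1 : c < 1) (n : ℕ) :
    IsPseudometric (D.iterDist obs c n) ∧
      Continuous fun p : E × E => D.iterDist obs c n p.1 p.2 := by
  induction n with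
  | zero =>
    refine ⟨⟨fun _ _ => abs_nonneg _, fun x y => ?_, fun x => ?_, fun x y => abs_sub_comm _ _,
      fun x y z => abs_sub_le _ _ _⟩, ((hobs.comp continuous_fst).sub
        (hobs.comp continuous_snd)).abs⟩
    · exact abs_sub_le_iff.2 ⟨by linarith [(hobs01 x).2, (hobs01 y).1],
        by linarith [(hobs01 y).2, (hobs01 x).1]⟩
    · simp [iterDist]
  | succ n ih => exact D.functionalG_isPseudometric hc0 hc1 ih.1 ih.2

theorem iterDist_monotone
    (D : Diffusion E) {obs : E → ℝ} (hobs : Continuous obs)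
    (hobs01 : ∀ x, 0 ≤ obs x ∧ obs x ≤ 1) {c : ℝ} (hc0 : 0 < c) (hc1 : c < 1)
    (x y : E) : Monotone fun n => D.iterDist obs c n x y := by
  refine monotone_nat_of_le_succ fun n => ?_
  induction n generalizing x y with
  | zero =>
    obtain ⟨h0, h0c⟩ := iterDist_isPseudometric D hobs hobs01 hc0 hc1 0
    have hh : Nonexpansive (discUnif c (D.iterDist obs c 0)) fun ω : Traj E => obs (ω 0) :=
      -- At time zero the discount is `1` and the law starts at `x`, so one transport step does not
      -- lose `obs`.
      ⟨fun ω ω' => by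
        have h := le_discUnif hc0 hc1 h0 ω ω' 0
        simp only [NNReal.coe_zero, Real.rpow_zero, one_mul] at h
        exact (le_abs_self _).trans h, fun _ => (hobs01 _).1, fun _ => (hobs01 _).2⟩
    have key : ∀ x y, obs x - obs y ≤ D.iterDist obs c 1 x y := fun x y => by
      have h := hh.integral_sub_le_transportCost (h0.discUnif hc0 hc1)
        (continuous_discUnif hc0 hc1 h0 h0c) (D.law x) (D.law y)
      rwa [D.integral_start obs, D.integral_start obs] at h
    exact (iterDist_isPseudometric D hobs hobs01 hc0 hc1 1).1.abs_sub_le key x y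
  | succ n ih =>
    obtain ⟨h1, h1c⟩ := iterDist_isPseudometric D hobs hobs01 hc0 hc1 n
    obtain ⟨h2, h2c⟩ := iterDist_isPseudometric D hobs hobs01 hc0 hc1 (n + 1)
    exact transportCost_mono (h1.discUnif hc0 hc1) (continuous_discUnif hc0 hc1 h1 h1c)
      (h2.discUnif hc0 hc1) (continuous_discUnif hc0 hc1 h2 h2c)
      (discUnif_mono hc0 hc1 h2 ih) _ _

/-! ### Expressions are nonexpansive -/

theorem interp_state_mem
    (D : Diffusion E) {obs : E → ℝ} (hobs : Continuous obs)
    (hobs01 : ∀ x, 0 ≤ obs x ∧ obs x ≤ 1) {c : ℝ} (hc0 : 0 < c) (hc1 : c < 1)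
    (f : LogicExpr .state) (x : E) :
    0 ≤ D.interp obs c f x ∧ D.interp obs c f x ≤ 1 :=
  (D.interp_wellDefined obs hobs hobs01 c hc0 hc1 f).2 x

theorem interp_traj_mem
    (D : Diffusion E) {obs : E → ℝ} (hobs : Continuous obs)
    (hobs01 : ∀ x, 0 ≤ obs x ∧ obs x ≤ 1) {c : ℝ} (hc0 : 0 < c) (hc1 : c < 1)
    (g : LogicExpr .traj) (ω : Traj E) :
    0 ≤ D.interp obs c g ω ∧ D.interp obs c g ω ≤ 1 :=
  (D.interp_wellDefined obs hobs hobs01 c hc0 hc1 g).2 ω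

/-! ### Lattice operations and truncations of nonexpansive functions -/

section Operations

variable {X : Type*} {k : X → X → ℝ} {g g₁ g₂ : X → ℝ}

theorem _root_.TrajMetric.Nonexpansive.min (h₁ : Nonexpansive k g₁) (h₂ : Nonexpansive k g₂) :
    Nonexpansive k fun x => Min.min (g₁ x) (g₂ x) := by
  refine ⟨fun x y => ?_, fun x => le_min (h₁.nonneg x) (h₂.nonneg x),
    fun x => (min_le_left _ _).trans (h₁.le_one x)⟩
  rcases min_choice (g₁ y) (g₂ y) with h | h <;> rw [h]
  · linarith [min_le_left (g₁ x) (g₂ x), h₁.sub_le x y]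
  · linarith [min_le_right (g₁ x) (g₂ x), h₂.sub_le x y]

theorem _root_.TrajMetric.Nonexpansive.max (h₁ : Nonexpansive k g₁) (h₂ : Nonexpansive k g₂) :
    Nonexpansive k fun x => Max.max (g₁ x) (g₂ x) := by
  refine ⟨fun x y => ?_, fun x => (h₁.nonneg x).trans (le_max_left _ _),
    fun x => max_le (h₁.le_one x) (h₂.le_one x)⟩
  rcases max_choice (g₁ x) (g₂ x) with h | h <;> rw [h]
  · linarith [le_max_left (g₁ y) (g₂ y), h₁.sub_le x y]
  · linarith [le_max_right (g₁ y) (g₂ y), h₂.sub_le x y]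

theorem _root_.TrajMetric.Nonexpansive.truncSub (hk : IsPseudometric k) (hg : Nonexpansive k g)
    {q : ℝ} (hq : 0 ≤ q) : Nonexpansive k fun x => Max.max 0 (g x - q) := by
  refine ⟨fun x y => ?_, fun x => le_max_left _ _,
    fun x => max_le zero_le_one (by linarith [hg.le_one x])⟩
  rcases max_choice 0 (g x - q) with h | h <;> rw [h]
  · linarith [le_max_left 0 (g y - q), hk.nonneg x y]
  · linarith [le_max_right 0 (g y - q), hg.sub_le x y]

theorem _root_.TrajMetric.Nonexpansive.truncAdd (hk : IsPseudometric k) (hg : Nonexpansive k g)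
    {q : ℝ} (hq : 0 ≤ q) : Nonexpansive k fun x => Min.min 1 (g x + q) := by
  refine ⟨fun x y => ?_, fun x => le_min zero_le_one (by linarith [hg.nonneg x]),
    fun x => min_le_left _ _⟩
  rcases min_choice 1 (g y + q) with h | h <;> rw [h]
  · linarith [min_le_left 1 (g x + q), hk.nonneg x y]
  · linarith [min_le_right 1 (g x + q), hg.sub_le x y]

end Operations

theorem nonexpansive_integral
    (D : Diffusion E) {obs : E → ℝ} (hobs : Continuous obs)
    (hobs01 : ∀ x, 0 ≤ obs x ∧ obs x ≤ 1) {c : ℝ} (hc0 : 0 < c) (hc1 : c < 1)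
    {n : ℕ} {g : LogicExpr .traj}
    (hg : Nonexpansive (discUnif c (D.iterDist obs c n)) (D.interp obs c g)) :
    Nonexpansive (D.iterDist obs c (n + 1)) (D.interp obs c (.integral g)) := by
  obtain ⟨h1, h1c⟩ := iterDist_isPseudometric D hobs hobs01 hc0 hc1 n
  exact ⟨fun x y => hg.integral_sub_le_transportCost (h1.discUnif hc0 hc1)
    (continuous_discUnif hc0 hc1 h1 h1c) (D.law x) (D.law y),
    fun x => (interp_state_mem D hobs hobs01 hc0 hc1 (.integral g) x).1,
    fun x => (interp_state_mem D hobs hobs01 hc0 hc1 (.integral g) x).2⟩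

theorem nonexpansive_ev
    (D : Diffusion E) {obs : E → ℝ} (hobs : Continuous obs)
    (hobs01 : ∀ x, 0 ≤ obs x ∧ obs x ≤ 1) {c : ℝ} (hc0 : 0 < c) (hc1 : c < 1)
    {n : ℕ} {f : LogicExpr .state}
    (hf : Nonexpansive (D.iterDist obs c n) (D.interp obs c f)) (t : ℚ≥0) :
    Nonexpansive (discUnif c (D.iterDist obs c n)) (D.interp obs c (.ev f t)) := by
  refine ⟨fun ω ω' => ?_, fun ω => (interp_traj_mem D hobs hobs01 hc0 hc1 (.ev f t) ω).1,
    fun ω => (interp_traj_mem D hobs hobs01 hc0 hc1 (.ev f t) ω).2⟩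
  have h := le_discUnif hc0 hc1 (iterDist_isPseudometric D hobs hobs01 hc0 hc1 n).1 ω ω' (t : ℝ≥0)
  rw [coe_nnratCast] at h
  refine le_trans ?_ h
  simp only [interp]
  rw [← mul_sub]
  exact mul_le_mul_of_nonneg_left (hf.sub_le _ _) (discount_nonneg hc0 _)

theorem nonexpansive_const
    (D : Diffusion E) {obs : E → ℝ} (hobs : Continuous obs)
    (hobs01 : ∀ x, 0 ≤ obs x ∧ obs x ≤ 1) {c : ℝ} (hc0 : 0 < c) (hc1 : c < 1)
    (n : ℕ) (q : Set.Icc (0 : ℚ) 1) :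
    Nonexpansive (D.iterDist obs c n) (D.interp obs c (.const q)) :=
  ⟨fun x y => by simpa [interp] using (iterDist_isPseudometric D hobs hobs01 hc0 hc1 n).1.nonneg x y,
    fun x => (interp_state_mem D hobs hobs01 hc0 hc1 (.const q) x).1,
    fun x => (interp_state_mem D hobs hobs01 hc0 hc1 (.const q) x).2⟩

theorem nonexpansive_obs (D : Diffusion E) {obs : E → ℝ}
    (hobs01 : ∀ x, 0 ≤ obs x ∧ obs x ≤ 1) (c : ℝ) :
    Nonexpansive (D.iterDist obs c 0) (D.interp obs c .obs) :=
  ⟨fun _ _ => le_abs_self _, fun x => (hobs01 x).1, fun x => (hobs01 x).2⟩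

/-- Every expression is nonexpansive for one of the iterates. -/
theorem exists_nonexpansive_interp
    (D : Diffusion E) {obs : E → ℝ} (hobs : Continuous obs)
    (hobs01 : ∀ x, 0 ≤ obs x ∧ obs x ≤ 1) {c : ℝ} (hc0 : 0 < c) (hc1 : c < 1) :
    ∀ {s : LogicSort} (e : LogicExpr s), (match s, e with
      | .state, f => ∃ n, Nonexpansive (D.iterDist obs c n) (D.interp obs c f)
      | .traj, g => ∃ n, Nonexpansive (discUnif c (D.iterDist obs c n)) (D.interp obs c g)) := by
  have hd := iterDist_isPseudometric D hobs hobs01 hc0 hc1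
  have hU := fun n => (hd n).1.discUnif hc0 hc1
  have hmono : ∀ {m n}, m ≤ n → ∀ ω ω' : Traj E,
      discUnif c (D.iterDist obs c m) ω ω' ≤ discUnif c (D.iterDist obs c n) ω ω' :=
    fun {m n} hmn => discUnif_mono hc0 hc1 (hd n).1 fun x y =>
      iterDist_monotone D hobs hobs01 hc0 hc1 x y hmn
  intro s e
  induction e with
  | const q => exact ⟨0, nonexpansive_const D hobs hobs01 hc0 hc1 0 q⟩
  | obs => exact ⟨0, D.nonexpansive_obs hobs01 c⟩
  | compl f ih =>
    obtain ⟨n, hn⟩ := ih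
    exact ⟨n, hn.one_sub (hd n).1⟩
  | integral g ih =>
    obtain ⟨n, hn⟩ := ih
    exact ⟨n + 1, nonexpansive_integral D hobs hobs01 hc0 hc1 hn⟩
  | ev f t ih =>
    obtain ⟨n, hn⟩ := ih
    exact ⟨n, nonexpansive_ev D hobs hobs01 hc0 hc1 hn t⟩
  | min g₁ g₂ ih₁ ih₂ =>
    obtain ⟨m, hm⟩ := ih₁
    obtain ⟨n, hn⟩ := ih₂
    exact ⟨max m n, (hm.mono (hmono (le_max_left m n))).min (hn.mono (hmono (le_max_right m n)))⟩
  | max g₁ g₂ ih₁ ih₂ =>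
    obtain ⟨m, hm⟩ := ih₁
    obtain ⟨n, hn⟩ := ih₂
    exact ⟨max m n, (hm.mono (hmono (le_max_left m n))).max (hn.mono (hmono (le_max_right m n)))⟩
  | minus g q ih =>
    obtain ⟨n, hn⟩ := ih
    exact ⟨n, hn.truncSub (hU n) (by exact_mod_cast q.2.1)⟩
  | plus g q ih =>
    obtain ⟨n, hn⟩ := ih
    exact ⟨n, hn.truncAdd (hU n) (by exact_mod_cast q.2.1)⟩

/-! ### Expressions attain the iterates -/

/-- The nonexpansive expressions on states approximate `dₙ` from below. -/
def Separates (D : Diffusion E) (obs : E → ℝ) (c : ℝ) (n : ℕ) : Prop :=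
  ∀ x y, ∀ ε > 0, ∃ f : LogicExpr .state, Nonexpansive (D.iterDist obs c n) (D.interp obs c f) ∧
    D.iterDist obs c n x y - ε ≤ D.interp obs c f x - D.interp obs c f y

/-- Evaluation at a rational time that nearly attains the supremum, applied to a state expression
separating the two positions there; the discount only shrinks the error. -/
theorem Separates.exists_traj
    (D : Diffusion E) {obs : E → ℝ} (hobs : Continuous obs)
    (hobs01 : ∀ x, 0 ≤ obs x ∧ obs x ≤ 1) {c : ℝ} (hc0 : 0 < c) (hc1 : c < 1)
    {n : ℕ} (hS : D.Separates obs c n) (ω ω' : Traj E) {ε : ℝ}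
    (hε : 0 < ε) :
    ∃ g : LogicExpr .traj, Nonexpansive (discUnif c (D.iterDist obs c n)) (D.interp obs c g) ∧
      discUnif c (D.iterDist obs c n) ω ω' - ε ≤ D.interp obs c g ω - D.interp obs c g ω' := by
  obtain ⟨q, hq⟩ := exists_nnrat_lt_discUnif hc0 (iterDist_isPseudometric D hobs hobs01 hc0 hc1 n).2
    (sub_lt_self (discUnif c (D.iterDist obs c n) ω ω') (half_pos hε))
  obtain ⟨f, hf, hle⟩ := hS (ω (q : ℝ≥0)) (ω' (q : ℝ≥0)) (ε / 2) (half_pos hε)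
  refine ⟨.ev f q, nonexpansive_ev D hobs hobs01 hc0 hc1 hf q, ?_⟩
  have h1 := mul_le_mul_of_nonneg_left hle (discount_nonneg hc0 (q : ℝ))
  have h2 : c ^ (q : ℝ) * (ε / 2) ≤ ε / 2 :=
    mul_le_of_le_one_left (half_pos hε).le (discount_le_one hc0 hc1 (q : ℝ≥0))
  simp only [interp]
  rw [mul_sub, mul_sub] at h1
  linarith

/-- Two-point interpolation of nonexpansive functions by expressions. -/
theorem Separates.exists_interpolation
    (D : Diffusion E) {obs : E → ℝ} (hobs : Continuous obs)
    (hobs01 : ∀ x, 0 ≤ obs x ∧ obs x ≤ 1) {c : ℝ} (hc0 : 0 < c) (hc1 : c < 1)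
    {n : ℕ} (hS : D.Separates obs c n) {h : Traj E → ℝ}
    (hh : Nonexpansive (discUnif c (D.iterDist obs c n)) h) (ω ω' : Traj E) {ε : ℝ}
    (hε : 0 < ε) :
    ∃ g : LogicExpr .traj, Nonexpansive (discUnif c (D.iterDist obs c n)) (D.interp obs c g) ∧
      |D.interp obs c g ω - h ω| ≤ ε ∧ |D.interp obs c g ω' - h ω'| ≤ ε := by
  wlog hle : h ω' ≤ h ω generalizing ω ω'
  · obtain ⟨g, hg, h1, h2⟩ := this ω' ω (not_le.1 hle).le
    exact ⟨g, hg, h2, h1⟩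
  have hU := (iterDist_isPseudometric D hobs hobs01 hc0 hc1 n).1.discUnif hc0 hc1
  have hδ : 0 < ε / 4 := by positivity
  obtain ⟨g₀, hg₀, hsep⟩ := hS.exists_traj D hobs hobs01 hc0 hc1 ω ω' hδ
  obtain ⟨q₁, hq₁⟩ := exists_unit_rat_near (hg₀.nonneg ω') (hg₀.le_one ω') hδ
  obtain ⟨q₂, hq₂⟩ := exists_unit_rat_near (sub_nonneg.2 hle)
    ((hh.sub_le ω ω').trans (hU.le_one ω ω')) hδ
  obtain ⟨q₃, hq₃⟩ := exists_unit_rat_near (hh.nonneg ω') (hh.le_one ω') hδ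
  have hp₁ : (0 : ℝ) ≤ ((q₁ : ℚ) : ℝ) := by exact_mod_cast q₁.2.1
  have hp₃ : (0 : ℝ) ≤ ((q₃ : ℚ) : ℝ) := by exact_mod_cast q₃.2.1
  -- With `q₁ ≈ g₀ ω'`, `q₂ ≈ h ω - h ω'` and `q₃ ≈ h ω'`: subtracting `q₁` brings the value at `ω'`
  -- near `0`, the cap `q₂` trims the value at `ω` to the required gap, and `q₃` lifts both. The
  -- constant `q₂` becomes a trajectory expression by evaluation at time `0`, where the discount is
  -- `1`.
  refine ⟨.plus (.min (.minus g₀ q₁) (.ev (.const q₂) 0)) q₃,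
    ((hg₀.truncSub hU hp₁).min
      (nonexpansive_ev D hobs hobs01 hc0 hc1 (nonexpansive_const D hobs hobs01 hc0 hc1 n q₂) 0)).truncAdd
        hU hp₃, ?_⟩
  have hq2 : (0 : ℝ) ≤ ((q₂ : ℚ) : ℝ) := by exact_mod_cast q₂.2.1
  have hd := hh.sub_le ω ω'
  have b1 := hh.le_one ω
  have b2 := hh.le_one ω'
  simp only [interp, NNRat.cast_zero, Real.rpow_zero, one_mul]
  generalize D.interp obs c g₀ ω = u at *
  generalize D.interp obs c g₀ ω' = u' at *
  generalize ((q₁ : ℚ) : ℝ) = r₁ at *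
  generalize ((q₂ : ℚ) : ℝ) = r₂ at *
  generalize ((q₃ : ℚ) : ℝ) = r₃ at *
  rw [abs_le] at hq₁ hq₂ hq₃
  constructor
  · rw [abs_le]
    constructor
    · have h3 : h ω - h ω' - ε / 2 ≤ Min.min (Max.max 0 (u - r₁)) r₂ :=
        le_min (le_max_of_le_right (by linarith)) (by linarith)
      have h4 : h ω - ε ≤ Min.min 1 (Min.min (Max.max 0 (u - r₁)) r₂ + r₃) :=
        le_min (by linarith) (by linarith)
      linarith
    · linarith [min_le_right 1 (Min.min (Max.max 0 (u - r₁)) r₂ + r₃),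
        min_le_right (Max.max 0 (u - r₁)) r₂]
  · rw [abs_le]
    constructor
    · have h3 : 0 ≤ Min.min (Max.max 0 (u' - r₁)) r₂ := le_min (le_max_left _ _) hq2
      have h4 : h ω' - ε ≤ Min.min 1 (Min.min (Max.max 0 (u' - r₁)) r₂ + r₃) :=
        le_min (by linarith) (by linarith)
      linarith
    · have h3 : Max.max 0 (u' - r₁) ≤ ε / 4 := max_le hδ.le (by linarith)
      linarith [min_le_right 1 (Min.min (Max.max 0 (u' - r₁)) r₂ + r₃),
        min_le_left (Max.max 0 (u' - r₁)) r₂]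

/-- A nearly optimal potential for `dₙ₊₁(x, y)` is a pointwise limit of trajectory expressions
bounded by `1`, so their integrals under both laws converge, and a late one separates `x` and `y`
almost as well. -/
theorem Separates.succ
    (D : Diffusion E) {obs : E → ℝ} (hobs : Continuous obs)
    (hobs01 : ∀ x, 0 ≤ obs x ∧ obs x ≤ 1) {c : ℝ} (hc0 : 0 < c) (hc1 : c < 1)
    {n : ℕ} (hS : D.Separates obs c n) : D.Separates obs c (n + 1) := by
  intro x y ε hε
  obtain ⟨hd, hdc⟩ := iterDist_isPseudometric D hobs hobs01 hc0 hc1 n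
  have hU := hd.discUnif hc0 hc1
  have hUc := continuous_discUnif hc0 hc1 hd hdc
  have hne : Nonempty (Traj E) :=
    nonempty_of_isProbabilityMeasure (D.law x : Measure (Traj E))
  obtain ⟨h, hh, hle⟩ := exists_nonexpansive_transportCost_le hU hUc (D.law x) (D.law y)
    (half_pos hε)
  let A : Set (Traj E → ℝ) := {F | ∃ g : LogicExpr .traj,
    Nonexpansive (discUnif c (D.iterDist obs c n)) (D.interp obs c g) ∧ D.interp obs c g = F}
  obtain ⟨G, hGA, hG⟩ := exists_seq_tendsto_of_interpolation hU hUc (A := A) (h := h)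
    (by
      rintro _ ⟨g₁, h₁, rfl⟩ _ ⟨g₂, h₂, rfl⟩
      exact ⟨.max g₁ g₂, h₁.max h₂, rfl⟩)
    (by
      rintro _ ⟨g₁, h₁, rfl⟩ _ ⟨g₂, h₂, rfl⟩
      exact ⟨.min g₁ g₂, h₁.min h₂, rfl⟩)
    (by
      rintro _ ⟨g, hg, rfl⟩
      exact hg) hh
    (fun ω ω' δ hδ => by
      obtain ⟨g, hg, h1, h2⟩ := hS.exists_interpolation D hobs hobs01 hc0 hc1 hh ω ω' hδ
      exact ⟨_, ⟨g, hg, rfl⟩, h1, h2⟩)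
  choose g hg hgG using hGA
  have hlim : ∀ z, Tendsto (fun i => ∫ ω, D.interp obs c (g i) ω ∂(D.law z : Measure (Traj E)))
      atTop (𝓝 (∫ ω, h ω ∂(D.law z : Measure (Traj E)))) := fun z => by
    refine tendsto_integral_of_dominated_convergence (fun _ => 1)
      (fun i => ((hg i).integrable hU hUc (D.law z)).aestronglyMeasurable) (integrable_const _)
      (fun i => Eventually.of_forall fun ω => ?_) (Eventually.of_forall fun ω => ?_)
    · rw [Real.norm_eq_abs, abs_of_nonneg ((hg i).nonneg ω)]
      exact (hg i).le_one ω
    · simpa only [hgG] using hG ω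
  obtain ⟨i, hi⟩ := (((hlim x).sub (hlim y)).eventually
    (lt_mem_nhds (sub_lt_self _ (half_pos hε)))).exists
  refine ⟨.integral (g i), nonexpansive_integral D hobs hobs01 hc0 hc1 (hg i), ?_⟩
  simp only [interp]
  change transportCost (discUnif c (D.iterDist obs c n)) (D.law x) (D.law y) - ε ≤ _
  linarith

theorem separates_iterDist
    (D : Diffusion E) {obs : E → ℝ} (hobs : Continuous obs)
    (hobs01 : ∀ x, 0 ≤ obs x ∧ obs x ≤ 1) {c : ℝ} (hc0 : 0 < c) (hc1 : c < 1)
    (n : ℕ) : D.Separates obs c n := by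
  induction n with
  | zero =>
    intro x y ε hε
    have h0 := D.nonexpansive_obs hobs01 c
    rcases le_total (obs y) (obs x) with h | h
    · refine ⟨.obs, h0, ?_⟩
      simp only [iterDist, interp, abs_of_nonneg (sub_nonneg.2 h)]
      linarith
    -- `Separates` is directed, so the opposite order of `obs` needs the complement.
    · refine ⟨.compl .obs, h0.one_sub (iterDist_isPseudometric D hobs hobs01 hc0 hc1 0).1, ?_⟩
      simp only [iterDist, interp, abs_of_nonpos (sub_nonpos.2 h)]
      linarith
  | succ n ih => exact ih.succ D hobs hobs01 hc0 hc1

theorem logicDist_eq_fixDist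
    (D : Diffusion E) {obs : E → ℝ} (hobs : Continuous obs)
    (hobs01 : ∀ x, 0 ≤ obs x ∧ obs x ≤ 1) {c : ℝ} (hc0 : 0 < c) (hc1 : c < 1)
    (x y : E) : D.logicDist obs c x y = D.fixDist obs c x y := by
  have hd := iterDist_isPseudometric D hobs hobs01 hc0 hc1
  have hne : Nonempty (LogicExpr .state) := ⟨.obs⟩
  apply le_antisymm
  · refine ciSup_le fun f => ?_
    obtain ⟨n, hn⟩ := exists_nonexpansive_interp D hobs hobs01 hc0 hc1 f
    refine ((hd n).1.abs_sub_le hn.sub_le x y).trans ?_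
    exact le_ciSup (f := fun n => D.iterDist obs c n x y)
      ⟨1, by rintro _ ⟨n, rfl⟩; exact (hd n).1.le_one x y⟩ n
  · refine ciSup_le fun n => le_of_forall_pos_le_add fun ε hε => ?_
    obtain ⟨f, -, hf⟩ := separates_iterDist D hobs hobs01 hc0 hc1 n x y ε hε
    have hbdd : BddAbove (Set.range fun f : LogicExpr .state =>
        |D.interp obs c f x - D.interp obs c f y|) := ⟨1, by
      rintro _ ⟨f, rfl⟩
      have hx := interp_state_mem D hobs hobs01 hc0 hc1 f x
      have hy := interp_state_mem D hobs hobs01 hc0 hc1 f y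
      exact abs_sub_le_iff.2 ⟨by linarith [hx.2, hy.1], by linarith [hx.1, hy.2]⟩⟩
    have h1 : |D.interp obs c f x - D.interp obs c f y| ≤ D.logicDist obs c x y :=
      le_ciSup hbdd f
    linarith [le_abs_self (D.interp obs c f x - D.interp obs c f y)]

end Diffusion

end TrajMetric

theorem mainTheorem4 {E : Type*} [TopologicalSpace E] [LocallyCompactSpace E] [T2Space E]
    [SecondCountableTopology E] [MeasurableSpace E] [BorelSpace E]
    (D : TrajMetric.Diffusion E) (obs : E → ℝ) (hobs : Continuous obs)
    (hobs01 : ∀ x, 0 ≤ obs x ∧ obs x ≤ 1) (c : ℝ) (hc0 : 0 < c) (hc1 : c < 1) :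
    (∀ n, TrajMetric.IsPseudometric (D.iterDist obs c n) ∧
      Continuous fun p : E × E => D.iterDist obs c n p.1 p.2) ∧
    ∀ x y, D.logicDist obs c x y = D.fixDist obs c x y :=
  ⟨D.iterDist_isPseudometric hobs hobs01 hc0 hc1, D.logicDist_eq_fixDist hobs hobs01 hc0 hc1⟩
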